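/- Let $d$ be a non-zero square-free integer (possibly negative), and let $E^d/\mathbb{Q}$ be the elliptic curve $y^2 = x^3 - 4320d^2x + 96768d^3$. Fix an algebraic closure $\overline{\mathbb{Q}}$ of $\mathbb{Q}$, and for $n\ge 1$ let $\mathbb{Q}(E^d[n])\subset\overline{\mathbb{Q}}$ be the field generated over $\mathbb{Q}$ by the affine coordinates of all non-zero points $P\in E^d(\overline{\mathbb{Q}})$ with $nP=0$. Put $f_4(x)=x^8+6x^4+1$ and $$\begin{aligned} f_8(x)={}&x^{32} + 16x^{31} + 128x^{30} + 672x^{29} + 2544x^{28} + 7200x^{27} + 15352x^{26} + 24272x^{25} + 26904x^{24} + 17312x^{23}\\ &- 304x^{22} - 11984x^{21} - 9672x^{20} - 2720x^{19} - 3592x^{18} - 7552x^{17} - 2798x^{16} + 6224x^{15} + 6368x^{14} - 672x^{13}\\ &- 2224x^{12} + 3360x^{11} + 4952x^{10} - 1072x^9 - 4600x^8 - 1120x^7 + 1776x^6 + 752x^5 - 264x^4 - 96x^3 + 24x^2 + 1. \end{aligned}$$ Then, for any root $\alpha$ of $f_4$ and any root $\beta$ of $f_8$ in $\overline{\mathbb{Q}}$,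 and for any choice of the roots $\sqrt{2}$, $\sqrt{d}$, $\sqrt[4]{2}$ in $\overline{\mathbb{Q}}$: \begin{itemize} \item $\mathbb{Q}(E^d[2])=\mathbb{Q}(\sqrt{2})$; \item $\mathbb{Q}(E^d[4])=\mathbb{Q}(\alpha,\sqrt{d}\,\sqrt[4]{2})$; \item $\mathbb{Q}(E^d[8])=\mathbb{Q}(\beta,\sqrt{d})$. \end{itemize} In particular, $[\mathbb{Q}(E^d[2]):\mathbb{Q}]=2$ and $[\mathbb{Q}(E^d[4]):\mathbb{Q}]=16$; moreover $[\mathbb{Q}(E^d[8]):\mathbb{Q}]=32$ if and only if $d\in\{\pm1,\pm2\}$, and otherwise $[\mathbb{Q}(E^d[8]):\mathbb{Q}]=64$. -/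

import Mathlib

open Polynomial

/-- The curve `E^d : y² = x³ - 4320 d² x + 96768 d³` over `ℚ`. -/
def curveE (d : ℤ) : WeierstrassCurve ℚ where
  a₁ := 0
  a₂ := 0
  a₃ := 0
  a₄ := -4320 * (d : ℚ) ^ 2
  a₆ := 96768 * (d : ℚ) ^ 3

/-- The `n`-division field `ℚ(W[n])` inside an extension `Ω` of `ℚ`: the field generated over `ℚ`
by the affine coordinates of the points `P ∈ W(Ω)` with `n • P = 0`. For `Ω` algebraically closed
this is the usual division field. -/
def divisionField (W : WeierstrassCurve ℚ) (Ω : Type*) [Field Ω] [Algebra ℚ Ω] [DecidableEq Ω]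
    (n : ℕ) : IntermediateField ℚ Ω :=
  IntermediateField.adjoin ℚ
    {z : Ω | ∃ (x y : Ω) (h : (W.baseChange Ω).toAffine.Nonsingular x y),
      n • WeierstrassCurve.Affine.Point.some x y h = 0 ∧ (z = x ∨ z = y)}

/-- `f₄ = x⁸ + 6x⁴ + 1`. -/
noncomputable def f4 : ℚ[X] := X ^ 8 + 6 * X ^ 4 + 1

/-- The polynomial `f₈` of degree 32. -/
noncomputable def f8 : ℚ[X] :=
  X ^ 32 + 16 * X ^ 31 + 128 * X ^ 30 + 672 * X ^ 29 + 2544 * X ^ 28 + 7200 * X ^ 27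
    + 15352 * X ^ 26 + 24272 * X ^ 25 + 26904 * X ^ 24 + 17312 * X ^ 23 - 304 * X ^ 22
    - 11984 * X ^ 21 - 9672 * X ^ 20 - 2720 * X ^ 19 - 3592 * X ^ 18 - 7552 * X ^ 17
    - 2798 * X ^ 16 + 6224 * X ^ 15 + 6368 * X ^ 14 - 672 * X ^ 13 - 2224 * X ^ 12
    + 3360 * X ^ 11 + 4952 * X ^ 10 - 1072 * X ^ 9 - 4600 * X ^ 8 - 1120 * X ^ 7
    + 1776 * X ^ 6 + 752 * X ^ 5 - 264 * X ^ 4 - 96 * X ^ 3 + 24 * X ^ 2 + 1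

/-! ### Torsion points on the curve -/

namespace CurveE

open WeierstrassCurve

variable {Ω : Type*} [Field Ω] [Algebra ℚ Ω]

/-! With `r² = d`, the substitution `x = d(36u + 48)`, `y = 216drv` turns every `E^d` into the one
curve `v² = u³ + 4u² + 2u`. This curve has complex multiplication by `θ = √-2`: multiplication by
`θ` sends the abscissa `u` to `-(v/u)²/2`. A chain of preimages of `(0,0)` under `θ` is therefore a
sequence of square roots, namely `0, t³p, it³, t²(1-p), w` with `t = ⁴√2` and `p = √(1+√2)`. Since
`θ² = -2`, doubling goes back two steps (`two_nsmul_chain`). Two consecutive members of the chain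
generate the 2-, 4- or 8-torsion, which is proved by halving generators
(`exists_zsmul_add_of_halves`).

Reading off coordinates gives `ℚ(E^d[4]) = ℚ(i, √2, p, rt)` and `ℚ(E^d[8]) = ℚ(i, t, p, w, r)`. The
twist enters the 4-torsion only through `rt`; at level 8 an abscissa already yields `t`, so `r`
itself appears.

For the degrees, `ℚ(i, t, p, w)` is built by adjoining the square roots `i, √2, p, t, w` in turn.
Each layer has degree 2 because taking norms of a supposed square leads to one of `-1, 2, -2` being
a rational square. The same descent shows that the only rational square classes that become trivial
in this field of degree 32 are those of `±1, ±2`, so adjoining `√d` doubles the degree except for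
these `d` (`IsTower.mem_eightField_iff`).

It remains to match the given polynomials. A root of `f4` produces `i` and `θ` by explicit formulas.
For `f8`, with `y = 2β + 1`, the value `2³² f8(β)` is an iterated norm of a quadratic polynomial in
`y`, so its vanishing allows the square roots to be chosen one after another, ending with an
expression of `y` in a tower (`IsExpressed`). The tower is uniquely determined by `y`
(`IsExpressed.unique`), and this forces each chosen square root to lie in `ℚ(β)`. -/

/-- The curve over `Ω` in affine coordinates. -/
abbrev overField (d : ℤ) (Ω : Type*) [Field Ω] [Algebra ℚ Ω] : WeierstrassCurve.Affine Ω :=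
  ((curveE d).baseChange Ω).toAffine

theorem a₁_overField (d : ℤ) : (overField d Ω).a₁ = 0 := by simp [overField, curveE]
theorem a₂_overField (d : ℤ) : (overField d Ω).a₂ = 0 := by simp [overField, curveE]
theorem a₃_overField (d : ℤ) : (overField d Ω).a₃ = 0 := by simp [overField, curveE]
theorem a₄_overField (d : ℤ) : (overField d Ω).a₄ = -4320 * (d : Ω) ^ 2 := by
  have : CharZero Ω := algebraRat.charZero Ω
  simp [overField, curveE]
theorem a₆_overField (d : ℤ) : (overField d Ω).a₆ = 96768 * (d : Ω) ^ 3 := by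
  have : CharZero Ω := algebraRat.charZero Ω
  simp [overField, curveE]

theorem negY_overField (d : ℤ) (x y : Ω) : (overField d Ω).negY x y = -y := by
  rw [Affine.negY, a₁_overField, a₃_overField]
  ring

theorem nonsingular_iff {d : ℤ} (hd : d ≠ 0) (x y : Ω) :
    (overField d Ω).Nonsingular x y ↔
      y ^ 2 = x ^ 3 - 4320 * (d : Ω) ^ 2 * x + 96768 * (d : Ω) ^ 3 := by
  have : CharZero Ω := algebraRat.charZero Ω
  have hd' : (d : Ω) ≠ 0 := Int.cast_ne_zero.mpr hd
  rw [← Affine.equation_iff_nonsingular_of_Δ_ne_zero, Affine.equation_iff, a₁_overField,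
    a₂_overField, a₃_overField, a₄_overField, a₆_overField]
  · constructor <;> intro h <;> linear_combination h
  · have : (overField d Ω).Δ = 1114512556032 * (d : Ω) ^ 6 := by
      simp only [WeierstrassCurve.Δ, b₂, b₄, b₆, b₈, a₁_overField, a₂_overField, a₃_overField,
        a₄_overField, a₆_overField]
      ring
    rw [this]
    exact mul_ne_zero (by norm_num) (pow_ne_zero _ hd')

/-- The coordinates are `x = (6r)²(u + 4/3)` and `y = (6r)³v`: the shift removes the quadratic term
of `u³ + 4u² + 2u`, and `r` carries the quadratic twist by `d`. -/
theorem nonsingular_of_model {d : ℤ} (hd : d ≠ 0) {r u v : Ω} (hr : r ^ 2 = d)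
    (h : v ^ 2 = u ^ 3 + 4 * u ^ 2 + 2 * u) :
    (overField d Ω).Nonsingular (d * (36 * u + 48)) (216 * d * r * v) := by
  rw [nonsingular_iff hd]
  linear_combination 46656 * (d : Ω) ^ 2 * r ^ 2 * h +
    46656 * (d : Ω) ^ 2 * (u ^ 3 + 4 * u ^ 2 + 2 * u) * hr

variable [DecidableEq Ω]

/-- Tangent construction in the `(u, v)` model, with `l` the slope there; the slope on `E^d` is
`6rl`, since `y` scales by `(6r)³` and `x` by `(6r)²`. -/
theorem two_nsmul_of_model {d : ℤ} (hd : d ≠ 0) {r u v l : Ω} (hr : r ^ 2 = d)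
    (hv : v ≠ 0) (hl : 2 * v * l = 3 * u ^ 2 + 8 * u + 2)
    {x y x' y' : Ω} (h : (overField d Ω).Nonsingular x y) (h' : (overField d Ω).Nonsingular x' y')
    (hx : x = d * (36 * u + 48)) (hy : y = 216 * d * r * v)
    (hx' : x' = d * (36 * (l ^ 2 - 4 - 2 * u) + 48))
    (hy' : y' = 216 * d * r * (-(l * (l ^ 2 - 4 - 2 * u - u) + v))) :
    2 • Affine.Point.some x y h = Affine.Point.some x' y' h' := by
  have : CharZero Ω := algebraRat.charZero Ω
  have hd' : (d : Ω) ≠ 0 := Int.cast_ne_zero.mpr hd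
  have hr0 : r ≠ 0 := by rintro rfl; apply hd'; rw [← hr]; ring
  have hy0 : y ≠ 0 := by
    rw [hy]
    exact mul_ne_zero (mul_ne_zero (mul_ne_zero (by norm_num) hd') hr0) hv
  have hne : y ≠ (overField d Ω).negY x y := by
    rw [negY_overField]
    exact fun h => hy0 (self_eq_neg.mp h)
  have hslope : (overField d Ω).slope x x y y = 6 * r * l := by
    rw [Affine.slope_of_Y_ne rfl hne, negY_overField, a₁_overField, a₂_overField, a₄_overField,
      div_eq_iff (by simpa [← two_mul] using hy0), hx, hy]
    linear_combination (-1296 * (d : Ω) ^ 2) * hl - 2592 * d * l * v * hr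
  rw [two_nsmul, Affine.Point.add_self_of_Y_ne hne, Affine.Point.some.injEq, hslope]
  simp only [Affine.addX, Affine.addY, Affine.negAddY, negY_overField, a₁_overField, a₂_overField]
  subst hx hy hx' hy'
  constructor
  · linear_combination 36 * l ^ 2 * hr
  · linear_combination (-216) * r * l ^ 3 * hr

theorem two_nsmul_eq_zero_iff {d : ℤ} {x y : Ω} (h : (overField d Ω).Nonsingular x y) :
    2 • Affine.Point.some x y h = 0 ↔ y = 0 := by
  have : CharZero Ω := algebraRat.charZero Ω
  rw [two_nsmul, add_eq_zero_iff_eq_neg, Affine.Point.neg_some, Affine.Point.some.injEq,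
    negY_overField]
  simp [self_eq_neg]

/-- The points with coordinates in the subfield `K`. -/
noncomputable def rationalPoints (d : ℤ) (K : IntermediateField ℚ Ω) :
    AddSubgroup (overField d Ω).Point :=
  (Affine.Point.map (W' := curveE d) (algebraMap K Ω).toRatAlgHom).range

theorem mem_rationalPoints_iff {d : ℤ} (K : IntermediateField ℚ Ω) {x y : Ω}
    (h : (overField d Ω).Nonsingular x y) :
    Affine.Point.some x y h ∈ rationalPoints d K ↔
      x ∈ K ∧ y ∈ K := by
  constructor
  · rintro ⟨_ | ⟨x', y', h'⟩, hP⟩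
    · exact absurd hP.symm (Affine.Point.some_ne_zero h)
    · rw [Affine.Point.map_some, Affine.Point.some.injEq] at hP
      exact ⟨hP.1 ▸ x'.2, hP.2 ▸ y'.2⟩
  · rintro ⟨hx, hy⟩
    exact ⟨.some ⟨x, hx⟩ ⟨y, hy⟩
      ((Affine.baseChange_nonsingular (curveE d) (f := (algebraMap K Ω).toRatAlgHom)
        (algebraMap K Ω).toRatAlgHom.injective ⟨x, hx⟩ ⟨y, hy⟩).mp h), rfl⟩

/-- The division field lies in any field of definition of two generators of the torsion. -/
theorem divisionField_le {d : ℤ} {n : ℕ} (K : IntermediateField ℚ Ω) {P Q : (overField d Ω).Point}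
    (hP : P ∈ rationalPoints d K)
    (hQ : Q ∈ rationalPoints d K)
    (hgen : ∀ R : (overField d Ω).Point, n • R = 0 → ∃ a b : ℤ, R = a • P + b • Q) :
    divisionField (curveE d) Ω n ≤ K := by
  rw [divisionField, IntermediateField.adjoin_le_iff]
  rintro z ⟨x, y, h, hn, hz⟩
  obtain ⟨a, b, hab⟩ := hgen _ hn
  have hmem := (mem_rationalPoints_iff K h).mp
    (hab ▸ add_mem (zsmul_mem hP a) (zsmul_mem hQ b))
  rcases hz with rfl | rfl
  exacts [hmem.1, hmem.2]

theorem mem_divisionField {d : ℤ} {n : ℕ} {x y : Ω} (h : (overField d Ω).Nonsingular x y)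
    (hn : n • Affine.Point.some x y h = 0) :
    x ∈ divisionField (curveE d) Ω n ∧ y ∈ divisionField (curveE d) Ω n :=
  ⟨IntermediateField.subset_adjoin _ _ ⟨x, y, h, hn, .inl rfl⟩,
    IntermediateField.subset_adjoin _ _ ⟨x, y, h, hn, .inr rfl⟩⟩

end CurveE

/-- Halving generators of the `n`-torsion gives generators of the `2n`-torsion, as soon as the
`2`-torsion is generated by multiples of the halves. -/
theorem exists_zsmul_add_of_halves {G : Type*} [AddCommGroup G] {n : ℕ} {k : ℤ} {P Q P' Q' : G}
    (hP : (2 : ℕ) • P' = P) (hQ : (2 : ℕ) • Q' = Q)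
    (h₂ : ∀ R : G, 2 • R = 0 → ∃ a b : ℤ, R = a • (k • P') + b • (k • Q'))
    (hn : ∀ R : G, n • R = 0 → ∃ a b : ℤ, R = a • P + b • Q) :
    ∀ R : G, (n * 2) • R = 0 → ∃ a b : ℤ, R = a • P' + b • Q' := by
  intro R hR
  obtain ⟨a, b, hab⟩ := hn (2 • R) (by rw [← mul_nsmul', hR])
  obtain ⟨a', b', hab'⟩ := h₂ (R - (a • P' + b • Q')) (by
    rw [nsmul_sub, hab, ← hP, ← hQ]
    module)
  refine ⟨a' * k + a, b' * k + b, ?_⟩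
  rw [sub_eq_iff_eq_add] at hab'
  rw [hab']
  module

/-! ### Generators of the 2-, 4- and 8-torsion -/

namespace CurveE

open WeierstrassCurve

variable {Ω : Type*} [Field Ω] [Algebra ℚ Ω]

theorem exists_zsmul_of_two_nsmul_eq_zero [DecidableEq Ω] {d : ℤ} (hd : d ≠ 0) {s : Ω}
    (hs : s ^ 2 = 2) (h₁ : (overField d Ω).Nonsingular (d * 48) 0)
    (h₂ : (overField d Ω).Nonsingular (d * (36 * (-2 - s) + 48)) 0)
    (R : (overField d Ω).Point) (hR : 2 • R = 0) :
    ∃ a b : ℤ, R = a • Affine.Point.some _ _ h₁ + b • Affine.Point.some _ _ h₂ := by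
  have : CharZero Ω := algebraRat.charZero Ω
  have hd' : (d : Ω) ≠ 0 := Int.cast_ne_zero.mpr hd
  have hs0 : s ≠ 0 := by rintro rfl; norm_num at hs
  have hs2 : -2 - s ≠ 0 := fun h => by
    have : (2 : Ω) = 0 := by linear_combination hs + (s - 2) * h
    norm_num at this
  have key : ∀ (x y : Ω) (h : (overField d Ω).Nonsingular x y),
      2 • Affine.Point.some x y h = 0 → y = 0 ∧ (x = d * 48 ∨ x = d * (36 * (-2 - s) + 48) ∨
        x = d * (36 * (-2 + s) + 48)) := by
    intro x y h h2
    have hy := (two_nsmul_eq_zero_iff h).mp h2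
    have hc := (nonsingular_iff hd x y).mp h
    refine ⟨hy, ?_⟩
    have : (x - d * 48) *
        ((x - d * (36 * (-2 - s) + 48)) * (x - d * (36 * (-2 + s) + 48))) = 0 := by
      rw [hy] at hc
      linear_combination -hc - 1296 * d ^ 2 * (x - d * 48) * hs
    rcases mul_eq_zero.mp this with h | h
    · exact .inl (sub_eq_zero.mp h)
    rcases mul_eq_zero.mp h with h | h
    · exact .inr (.inl (sub_eq_zero.mp h))
    · exact .inr (.inr (sub_eq_zero.mp h))
  set e₁ := Affine.Point.some _ _ h₁ with he₁
  set e₂ := Affine.Point.some _ _ h₂ with he₂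
  have he₁2 : 2 • e₁ = 0 := (two_nsmul_eq_zero_iff h₁).mpr rfl
  have he₂2 : 2 • e₂ = 0 := (two_nsmul_eq_zero_iff h₂).mpr rfl
  have hne : e₁ ≠ e₂ := by
    rw [he₁, he₂, Ne, Affine.Point.some.injEq]
    rintro ⟨h, -⟩
    have : (d : Ω) * (36 * (-2 - s)) = 0 := by linear_combination -h
    simp [hd', hs2] at this
  have hsum2 : 2 • (e₁ + e₂) = 0 := by rw [nsmul_add, he₁2, he₂2, add_zero]
  -- The sum is a nonzero 2-torsion point different from both summands, so it can only be the third
  -- one; no addition formula is needed.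
  obtain ⟨h₃, hsum⟩ : ∃ h₃ : (overField d Ω).Nonsingular (d * (36 * (-2 + s) + 48)) 0,
      e₁ + e₂ = .some _ _ h₃ := by
    rcases hE : e₁ + e₂ with _ | ⟨x, y, h⟩
    · exfalso
      apply hne
      have h0 : e₁ + e₂ = 0 := hE
      have : -e₂ = e₂ := by rw [neg_eq_iff_add_eq_zero, ← two_nsmul, he₂2]
      rw [← this]
      exact eq_neg_of_add_eq_zero_left h0
    · rw [hE] at hsum2
      obtain ⟨rfl, rfl | rfl | rfl⟩ := key x y h hsum2
      · exact absurd (add_eq_left.mp hE) (Affine.Point.some_ne_zero h₂)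
      · exact absurd (add_eq_right.mp hE) (Affine.Point.some_ne_zero h₁)
      · exact ⟨h, rfl⟩
  rcases R with _ | ⟨x, y, h⟩
  · exact ⟨0, 0, by simp [Affine.Point.zero_def]⟩
  · obtain ⟨rfl, rfl | rfl | rfl⟩ := key x y h hR
    · exact ⟨1, 0, by simp [he₁]⟩
    · exact ⟨0, 1, by simp [he₂]⟩
    · exact ⟨1, 1, by simp [hsum]⟩

/-- If `a₀`, `a`, `b` are consecutive square roots of `-2u` along a chain of preimages under
complex multiplication by `θ = √-2`, then `u = -c / 2` with `c = 4 - b² + θab` is the next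
abscissa on `v² = u³ + 4u² + 2u`, and doubling goes back two steps in the chain. -/
theorem two_nsmul_chain [DecidableEq Ω] {d : ℤ} (hd : d ≠ 0) {r θ a₀ a b c : Ω} (hr : r ^ 2 = d)
    (hθ : θ ^ 2 = -2) (hb : a * b ^ 2 = a * (4 - a ^ 2 + θ * a₀ * a))
    (hrel : b ^ 4 + 2 * a ^ 2 * b ^ 2 - 8 * b ^ 2 + 8 = 0) (hc : c = 4 - b ^ 2 + θ * a * b)
    {x y x' y' : Ω} (hx : x = d * (36 * (-c / 2) + 48)) (hy : y = 216 * d * r * (-c / 2 * b))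
    (hx' : x' = d * (36 * (-a ^ 2 / 2) + 48)) (hy' : y' = 216 * d * r * (a ^ 2 / 2 * a₀))
    (h : (overField d Ω).Nonsingular x y) (h' : (overField d Ω).Nonsingular x' y') :
    2 • Affine.Point.some x y h = Affine.Point.some x' y' h' := by
  have : CharZero Ω := algebraRat.charZero Ω
  -- This equation says that `u = -c/2` lies on the curve with `v/u = b`. As a quadratic in `c` it
  -- has quarter-discriminant `(b² - 4)² - 8`, which `hrel` turns into `(θab)²`.
  have hcrel : c ^ 2 + 2 * c * b ^ 2 - 8 * c + 8 = 0 := by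
    rw [hc]
    linear_combination a ^ 2 * b ^ 2 * hθ - hrel
  have hb0 : b ≠ 0 := by rintro rfl; norm_num at hrel
  have hc0 : c ≠ 0 := by rintro rfl; norm_num at hcrel
  -- From `u² + 4u + 2 = ub²` the tangent slope is `(2u + 4 + b²)/(2b)`, which becomes `b - θa/2`
  -- after inserting `hc`.
  refine two_nsmul_of_model hd hr (u := -c / 2) (v := -c / 2 * b) (l := b - θ / 2 * a)
    (mul_ne_zero (by simpa using hc0) hb0) ?_ h h' hx hy ?_ ?_
  · linear_combination (-1 / 4) * hcrel - c / 2 * hc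
  · rw [hx']
    linear_combination -36 * d * (hc + a ^ 2 / 4 * hθ)
  · rw [hy']
    linear_combination 216 * d * r * (a ^ 2 * a₀ / 4 * hθ + θ / 4 * hb - a ^ 2 * b / 4 * hθ -
      θ * a / 4 * hc + (b - θ / 2 * a) * (hc + a ^ 2 / 4 * hθ))

/-- The abscissa `u = -c / 2` of the next member of the chain gives a point of the curve. -/
theorem nonsingular_chain {d : ℤ} (hd : d ≠ 0) {r θ a b c : Ω} (hr : r ^ 2 = d)
    (hθ : θ ^ 2 = -2) (hrel : b ^ 4 + 2 * a ^ 2 * b ^ 2 - 8 * b ^ 2 + 8 = 0)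
    (hc : c = 4 - b ^ 2 + θ * a * b) :
    (overField d Ω).Nonsingular (d * (36 * (-c / 2) + 48)) (216 * d * r * (-c / 2 * b)) := by
  have : CharZero Ω := algebraRat.charZero Ω
  have hcrel : c ^ 2 + 2 * c * b ^ 2 - 8 * c + 8 = 0 := by
    rw [hc]
    linear_combination a ^ 2 * b ^ 2 * hθ - hrel
  exact nonsingular_of_model hd hr (by linear_combination c / 8 * hcrel)

/-- Generators `i`, `t = ⁴√2`, `p = √(1 + √2)` of the field of definition of the `4`-torsion of the
curve `v² = u³ + 4u² + 2u`. -/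
structure IsTower (i t p : Ω) : Prop where
  hi : i ^ 2 = -1
  ht : t ^ 4 = 2
  hp : p ^ 2 = 1 + t ^ 2

/-- The equation of the last generator of the field of definition of the `8`-torsion. -/
def IsLastGen (t p w : Ω) : Prop := w ^ 2 = 4 * p - 2 * t ^ 2 - 2 * t ^ 3 * (1 - p)

/-- The chain of square roots `0, t³p, it³, t²(1-p)` has abscissas `u = -a²/2` equal to `0, -2-t²,
t², -2-t²+2p`. The last two points double to the first two, which generate the 2-torsion. -/
theorem exists_generators_four_torsion [DecidableEq Ω] {d : ℤ} (hd : d ≠ 0) {r i t p : Ω}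
    (hr : r ^ 2 = d) (hT : IsTower i t p) :
    ∃ (h₃ : (overField d Ω).Nonsingular (d * (36 * t ^ 2 + 48)) (216 * d * r * (2 * t * p)))
      (h₄ : (overField d Ω).Nonsingular (d * (36 * (-2 - t ^ 2 + 2 * p) + 48))
        (216 * d * r * ((-2 - t ^ 2 + 2 * p) * (i * t ^ 3)))),
      4 • Affine.Point.some _ _ h₃ = 0 ∧ 4 • Affine.Point.some _ _ h₄ = 0 ∧
      (∀ R : (overField d Ω).Point, 2 • R = 0 → ∃ a b : ℤ,
        R = a • (2 • Affine.Point.some _ _ h₃) + b • (2 • Affine.Point.some _ _ h₄)) ∧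
      ∀ R : (overField d Ω).Point, 4 • R = 0 →
        ∃ a b : ℤ, R = a • Affine.Point.some _ _ h₃ + b • Affine.Point.some _ _ h₄ := by
  have : CharZero Ω := algebraRat.charZero Ω
  obtain ⟨hi, ht, hp⟩ := hT
  have hθ : (i * t ^ 2) ^ 2 = -2 := by linear_combination t ^ 4 * hi - ht
  have h₁ : (overField d Ω).Nonsingular (d * 48) 0 := by
    have := nonsingular_of_model hd hr (u := 0) (v := 0) (by ring)
    simpa using this
  have h₂ : (overField d Ω).Nonsingular (d * (36 * (-2 - t ^ 2) + 48)) 0 := by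
    have := nonsingular_of_model hd hr (u := -2 - t ^ 2) (v := 0)
      (by linear_combination (2 + t ^ 2) * ht)
    simpa using this
  have hrel₂ : (t ^ 3 * p) ^ 4 + 2 * 0 ^ 2 * (t ^ 3 * p) ^ 2 - 8 * (t ^ 3 * p) ^ 2 + 8 = 0 := by
    grind
  have hrel₃ : (i * t ^ 3) ^ 4 + 2 * (t ^ 3 * p) ^ 2 * (i * t ^ 3) ^ 2 - 8 * (i * t ^ 3) ^ 2 + 8 =
      0 := by
    grind
  have h₃ : (overField d Ω).Nonsingular (d * (36 * t ^ 2 + 48)) (216 * d * r * (2 * t * p)) := by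
    convert nonsingular_chain hd hr hθ hrel₂ (c := -2 * t ^ 2) (by grind) using 2
    · ring
    · grind
  have h₄ : (overField d Ω).Nonsingular (d * (36 * (-2 - t ^ 2 + 2 * p) + 48))
      (216 * d * r * ((-2 - t ^ 2 + 2 * p) * (i * t ^ 3))) := by
    convert nonsingular_chain hd hr hθ hrel₃ (c := 4 + 2 * t ^ 2 - 4 * p) (by grind) using 2
    · ring
    · ring
  -- The chain starts here with `a = 0`, where `b² = 4 - a² + θa₀a` itself fails; the factor `a` in
  -- that hypothesis of `two_nsmul_chain` admits this case.
  have h3 : 2 • Affine.Point.some _ _ h₃ = Affine.Point.some _ _ h₁ :=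
    two_nsmul_chain hd hr hθ (a₀ := 0) (a := 0) (b := t ^ 3 * p) (c := -2 * t ^ 2) (by ring) hrel₂
      (by grind) (by grind) (by grind) (by ring) (by ring) h₃ h₁
  have h4 : 2 • Affine.Point.some _ _ h₄ = Affine.Point.some _ _ h₂ :=
    two_nsmul_chain hd hr hθ (a₀ := 0) (a := t ^ 3 * p) (b := i * t ^ 3)
      (c := 4 + 2 * t ^ 2 - 4 * p) (by grind) hrel₃
      (by grind) (by ring) (by ring) (by grind) (by ring) h₄ h₂
  have hgen := exists_zsmul_of_two_nsmul_eq_zero hd (s := t ^ 2) (by linear_combination ht) h₁ h₂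
  refine ⟨h₃, h₄, ?_, ?_, ?_, ?_⟩
  · rw [show 4 = 2 * 2 from rfl, mul_nsmul, h3, two_nsmul_eq_zero_iff]
  · rw [show 4 = 2 * 2 from rfl, mul_nsmul, h4, two_nsmul_eq_zero_iff]
  · rwa [h3, h4]
  · refine exists_zsmul_add_of_halves (n := 2) (k := 2) h3 h4 ?_ hgen
    simpa only [ofNat_zsmul, h3, h4] using hgen

/-- Two more steps of the same chain, with square roots `t²(1-p)` and `w`. Doubling gives the
negatives of the 4-torsion generators, because `two_nsmul_chain` lands on the point with `v/u =
-a₀`; at the previous level the sign was invisible on 2-torsion. -/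
theorem exists_generators_eight_torsion [DecidableEq Ω] {d : ℤ} (hd : d ≠ 0) {r i t p w : Ω}
    (hr : r ^ 2 = d) (hT : IsTower i t p) (hw : IsLastGen t p w) :
    ∃ (h₅ : (overField d Ω).Nonsingular (d * (36 * (-w ^ 2 / 2) + 48))
        (216 * d * r * (-w ^ 2 / 2 * (t ^ 2 * (1 - p)))))
      (h₆ : (overField d Ω).Nonsingular
        (d * (36 * (-(4 - w ^ 2 + 2 * i * (1 - p) * w) / 2) + 48))
        (216 * d * r * (-(4 - w ^ 2 + 2 * i * (1 - p) * w) / 2 * w))),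
      8 • Affine.Point.some _ _ h₅ = 0 ∧ 8 • Affine.Point.some _ _ h₆ = 0 ∧
      4 - w ^ 2 + 2 * i * (1 - p) * w ≠ 0 ∧
      ∀ R : (overField d Ω).Point, 8 • R = 0 →
        ∃ a b : ℤ, R = a • Affine.Point.some _ _ h₅ + b • Affine.Point.some _ _ h₆ := by
  have : CharZero Ω := algebraRat.charZero Ω
  obtain ⟨h₃, h₄, h3, h4, hgen₂, hgen₄⟩ := exists_generators_four_torsion hd hr hT
  obtain ⟨hi, ht, hp⟩ := hT
  rw [IsLastGen] at hw
  have hθ : (i * t ^ 2) ^ 2 = -2 := by linear_combination t ^ 4 * hi - ht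
  have hrel₄ : (t ^ 2 * (1 - p)) ^ 4 + 2 * (i * t ^ 3) ^ 2 * (t ^ 2 * (1 - p)) ^ 2
      - 8 * (t ^ 2 * (1 - p)) ^ 2 + 8 = 0 := by grind
  have hrel₅ : w ^ 4 + 2 * (t ^ 2 * (1 - p)) ^ 2 * w ^ 2 - 8 * w ^ 2 + 8 = 0 := by grind
  have hc₅ : w ^ 2 = 4 - (t ^ 2 * (1 - p)) ^ 2 + i * t ^ 2 * (i * t ^ 3) * (t ^ 2 * (1 - p)) := by
    grind
  have hc₆ : 4 - w ^ 2 + 2 * i * (1 - p) * w =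
      4 - w ^ 2 + i * t ^ 2 * (t ^ 2 * (1 - p)) * w := by grind
  have h₅ := nonsingular_chain hd hr hθ hrel₄ hc₅
  have h₆ := nonsingular_chain hd hr hθ hrel₅ hc₆
  have h5 : 2 • Affine.Point.some _ _ h₅ = -Affine.Point.some _ _ h₃ := by
    rw [Affine.Point.neg_some]
    refine two_nsmul_chain hd hr hθ (a₀ := t ^ 3 * p) (a := i * t ^ 3) (b := t ^ 2 * (1 - p))
      (by grind) hrel₄ hc₅ rfl rfl (by grind) ?_ h₅ _
    rw [negY_overField]
    grind
  have h6 : 2 • Affine.Point.some _ _ h₆ = -Affine.Point.some _ _ h₄ := by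
    rw [Affine.Point.neg_some]
    refine two_nsmul_chain hd hr hθ (a₀ := i * t ^ 3) (a := t ^ 2 * (1 - p)) (b := w)
      (by grind) hrel₅ hc₆ rfl rfl (by grind) ?_ h₆ _
    rw [negY_overField]
    grind
  refine ⟨h₅, h₆, ?_, ?_, ?_, ?_⟩
  · rw [show 8 = 2 * 4 from rfl, mul_nsmul, h5, smul_neg, h3, neg_zero]
  · rw [show 8 = 2 * 4 from rfl, mul_nsmul, h6, smul_neg, h4, neg_zero]
  · grind
  · intro R hR
    have h5' : 2 • (-Affine.Point.some _ _ h₅) = Affine.Point.some _ _ h₃ := by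
      rw [smul_neg, h5, neg_neg]
    have h6' : 2 • (-Affine.Point.some _ _ h₆) = Affine.Point.some _ _ h₄ := by
      rw [smul_neg, h6, neg_neg]
    obtain ⟨a, b, hab⟩ := exists_zsmul_add_of_halves (n := 4) (k := 4) h5' h6' (by
      simpa only [ofNat_zsmul, show 4 = 2 * 2 from rfl, mul_nsmul, h5', h6'] using hgen₂) hgen₄ R hR
    exact ⟨-a, -b, by rw [hab]; module⟩

end CurveE

/-! ### Reading off the tower from the coordinates of torsion points -/

namespace CurveE

open WeierstrassCurve

variable {Ω : Type*} [Field Ω] [Algebra ℚ Ω]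

/-- This realises `√2 ↦ -√2`: `t²` becomes `-t²`, and `(1 + t²)(1 - t²) = -1` makes `i/p` a square
root of `1 - t²`. -/
theorem IsTower.conj {i t p : Ω} (hT : IsTower i t p) :
    IsTower i (i * t) (i / p) := by
  have : CharZero Ω := algebraRat.charZero Ω
  obtain ⟨hi, ht, hp⟩ := hT
  have hp0 : p ≠ 0 := by rintro rfl; grind
  refine ⟨hi, by grind, ?_⟩
  rw [div_pow, div_eq_iff (pow_ne_zero _ hp0)]
  grind

theorem mem_of_smul_add_mem {d : ℤ} (hd : d ≠ 0) {u : Ω} {K : IntermediateField ℚ Ω}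
    (h : d * (36 * u + 48) ∈ K) : u ∈ K := by
  have : CharZero Ω := algebraRat.charZero Ω
  have hd' : (d : Ω) ≠ 0 := Int.cast_ne_zero.mpr hd
  have : u = (d * (36 * u + 48) / d - 48) / 36 := by
    field_simp
    ring
  rw [this]
  exact div_mem (sub_mem (div_mem h (intCast_mem _ _)) (ofNat_mem _ _)) (ofNat_mem _ _)

theorem mem_of_smul_mul_mem {d : ℤ} (hd : d ≠ 0) {r u b : Ω} (hu : u ≠ 0)
    {K : IntermediateField ℚ Ω} (huK : u ∈ K)
    (h : 216 * d * r * (u * b) ∈ K) : r * b ∈ K := by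
  have : CharZero Ω := algebraRat.charZero Ω
  have hd' : (d : Ω) ≠ 0 := Int.cast_ne_zero.mpr hd
  have : r * b = 216 * d * r * (u * b) / (216 * d * u) := by
    field_simp
  rw [this]
  exact div_mem h (mul_mem (mul_mem (ofNat_mem _ _) (intCast_mem _ _)) huK)

variable [DecidableEq Ω]

theorem divisionField_two_eq {d : ℤ} (hd : d ≠ 0) {s : Ω} (hs : s ^ 2 = 2) :
    divisionField (curveE d) Ω 2 = IntermediateField.adjoin ℚ {s} := by
  have : CharZero Ω := algebraRat.charZero Ω
  have hd' : (d : Ω) ≠ 0 := Int.cast_ne_zero.mpr hd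
  have h₁ : (overField d Ω).Nonsingular (d * 48) 0 := by
    rw [nonsingular_iff hd]; ring
  have h₂ : (overField d Ω).Nonsingular (d * (36 * (-2 - s) + 48)) 0 := by
    rw [nonsingular_iff hd]; grind
  have hgen := exists_zsmul_of_two_nsmul_eq_zero hd hs h₁ h₂
  apply le_antisymm
  · have hsK : s ∈ IntermediateField.adjoin ℚ {s} := IntermediateField.mem_adjoin_simple_self ℚ s
    refine divisionField_le _ ((mem_rationalPoints_iff _ h₁).mpr ⟨?_, zero_mem _⟩)
      ((mem_rationalPoints_iff _ h₂).mpr ⟨?_, zero_mem _⟩) hgen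
    · exact mul_mem (intCast_mem _ _) (ofNat_mem _ _)
    · exact mul_mem (intCast_mem _ _) (add_mem (mul_mem (ofNat_mem _ _) (sub_mem
        (neg_mem (ofNat_mem _ _)) hsK)) (ofNat_mem _ _))
  · rw [IntermediateField.adjoin_simple_le_iff]
    have hx := (mem_divisionField h₂ ((two_nsmul_eq_zero_iff h₂).mpr rfl)).1
    have : s = (48 - d * (36 * (-2 - s) + 48) / d) / 36 - 2 := by
      field_simp
      ring
    rw [this]
    exact sub_mem (div_mem (sub_mem (ofNat_mem _ _) (div_mem hx (intCast_mem _ _)))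
      (ofNat_mem _ _)) (ofNat_mem _ _)

/-- In the generators, `t` occurs to even order in the abscissas and to odd order in the ordinates,
where it is accompanied by `r`; hence `t²` and `rt` suffice. -/
theorem divisionField_four_le {d : ℤ} (hd : d ≠ 0) {r i t p : Ω} (hr : r ^ 2 = d)
    (hT : IsTower i t p) {K : IntermediateField ℚ Ω} (hi : i ∈ K) (hs : t ^ 2 ∈ K) (hp : p ∈ K)
    (hrt : r * t ∈ K) : divisionField (curveE d) Ω 4 ≤ K := by
  obtain ⟨h₃, h₄, -, -, -, hgen⟩ := exists_generators_four_torsion hd hr hT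
  refine divisionField_le K ((mem_rationalPoints_iff _ h₃).mpr ⟨?_, ?_⟩)
      ((mem_rationalPoints_iff _ h₄).mpr ⟨?_, ?_⟩) hgen
  · repeat' first
      | assumption | exact ofNat_mem _ _ | exact intCast_mem _ _ | apply add_mem | apply mul_mem
  · rw [show 216 * (d : Ω) * r * (2 * t * p) = 216 * d * (r * t) * (2 * p) by ring]
    repeat' first
      | assumption | exact ofNat_mem _ _ | exact intCast_mem _ _ | apply add_mem | apply mul_mem
  · repeat' first
      | assumption | exact ofNat_mem _ _ | exact intCast_mem _ _
      | apply add_mem | apply sub_mem | apply neg_mem | apply mul_mem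
  · rw [show 216 * (d : Ω) * r * ((-2 - t ^ 2 + 2 * p) * (i * t ^ 3)) =
      216 * d * (r * t) * ((-2 - t ^ 2 + 2 * p) * (i * t ^ 2)) by ring]
    repeat' first
      | assumption | exact ofNat_mem _ _ | exact intCast_mem _ _
      | apply add_mem | apply sub_mem | apply neg_mem | apply mul_mem

theorem divisionField_eight_le {d : ℤ} (hd : d ≠ 0) {r i t p w : Ω} (hr : r ^ 2 = d)
    (hT : IsTower i t p) (hw : IsLastGen t p w) {K : IntermediateField ℚ Ω} (hi : i ∈ K)
    (htK : t ∈ K) (hp : p ∈ K) (hwK : w ∈ K) (hrK : r ∈ K) : divisionField (curveE d) Ω 8 ≤ K := by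
  obtain ⟨h₅, h₆, -, -, -, hgen⟩ := exists_generators_eight_torsion hd hr hT hw
  refine divisionField_le K ((mem_rationalPoints_iff _ h₅).mpr ⟨?_, ?_⟩)
      ((mem_rationalPoints_iff _ h₆).mpr ⟨?_, ?_⟩) hgen <;>
  repeat' first
    | assumption | exact one_mem _ | exact ofNat_mem _ _ | exact intCast_mem _ _
      | apply add_mem | apply sub_mem | apply neg_mem | apply mul_mem
      | apply div_mem | apply pow_mem

theorem mem_divisionField_four {d : ℤ} (hd : d ≠ 0) {r i t p : Ω} (hr : r ^ 2 = d)
    (hT : IsTower i t p) : i ∈ divisionField (curveE d) Ω 4 ∧ t ^ 2 ∈ divisionField (curveE d) Ω 4 ∧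
      p ∈ divisionField (curveE d) Ω 4 ∧ r * t ∈ divisionField (curveE d) Ω 4 := by
  have : CharZero Ω := algebraRat.charZero Ω
  have key : ∀ {t p : Ω}, IsTower i t p → t ^ 2 ∈ divisionField (curveE d) Ω 4 ∧
      p ∈ divisionField (curveE d) Ω 4 ∧ r * (i * t ^ 3) ∈ divisionField (curveE d) Ω 4 := by
    intro t p hT
    obtain ⟨h₃, h₄, h3, h4, -, -⟩ := exists_generators_four_torsion hd hr hT
    obtain ⟨hi, ht, hp⟩ := hT
    have ht2 := mem_of_smul_add_mem hd (mem_divisionField h₃ h3).1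
    have hu := mem_of_smul_add_mem hd (mem_divisionField h₄ h4).1
    refine ⟨ht2, ?_, mem_of_smul_mul_mem hd (by grind) hu (mem_divisionField h₄ h4).2⟩
    rw [show p = (-2 - t ^ 2 + 2 * p + (2 + t ^ 2)) / 2 by ring]
    exact div_mem (add_mem hu (add_mem (ofNat_mem _ _) ht2)) (ofNat_mem _ _)
  obtain ⟨h₁, h₂, h₃⟩ := key hT
  -- The conjugate tower describes the same curve, so `i/p` is in the division field along with `p`;
  -- their product is `i`.
  have hp' := (key hT.conj).2.1
  obtain ⟨hi, ht, hp⟩ := hT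
  have hp0 : p ≠ 0 := by rintro rfl; grind
  have ht0 : t ≠ 0 := by rintro rfl; grind
  have hi0 : i ≠ 0 := by rintro rfl; grind
  have hiK : i ∈ divisionField (curveE d) Ω 4 := by
    rw [show i = i / p * p by field_simp]
    exact mul_mem hp' h₂
  refine ⟨hiK, h₁, h₂, ?_⟩
  rw [show r * t = r * (i * t ^ 3) / (i * t ^ 2) by field_simp]
  exact div_mem h₃ (mul_mem hiK h₁)

theorem mem_divisionField_eight {d : ℤ} (hd : d ≠ 0) {r i t p w : Ω} (hr : r ^ 2 = d)
    (hT : IsTower i t p) (hw : IsLastGen t p w) :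
    i ∈ divisionField (curveE d) Ω 8 ∧ t ∈ divisionField (curveE d) Ω 8 ∧
      p ∈ divisionField (curveE d) Ω 8 ∧ w ∈ divisionField (curveE d) Ω 8 ∧
      r ∈ divisionField (curveE d) Ω 8 := by
  have : CharZero Ω := algebraRat.charZero Ω
  have hle : divisionField (curveE d) Ω 4 ≤ divisionField (curveE d) Ω 8 := by
    refine IntermediateField.adjoin.mono _ _ _ ?_
    rintro z ⟨x, y, h, hn, hz⟩
    exact ⟨x, y, h, by rw [show 8 = 4 * 2 from rfl, mul_nsmul, hn, nsmul_zero], hz⟩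
  obtain ⟨hiK, hsK, hpK, hrt⟩ := mem_divisionField_four hd hr hT
  replace hiK := hle hiK
  replace hsK := hle hsK
  replace hpK := hle hpK
  replace hrt := hle hrt
  obtain ⟨h₅, h₆, h5, h6, hne, -⟩ := exists_generators_eight_torsion hd hr hT hw
  have hu5 := mem_of_smul_add_mem hd (mem_divisionField h₅ h5).1
  have hu6 := mem_of_smul_add_mem hd (mem_divisionField h₆ h6).1
  have hrw := mem_of_smul_mul_mem hd (div_ne_zero (neg_ne_zero.mpr hne) two_ne_zero) hu6
    (mem_divisionField h₆ h6).2
  obtain ⟨hi, ht, hp⟩ := hT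
  rw [IsLastGen] at hw
  have hs0 : t ^ 2 ≠ 0 := by grind
  have ht0 : t ≠ 0 := by grind
  have h1p : 1 - p ≠ 0 := by grind
  -- The abscissa `-w²/2 = t² - 2p + t·t²(1-p)` is linear in `t` over `ℚ(t², p)`.
  have htK : t ∈ divisionField (curveE d) Ω 8 := by
    rw [show t = (-w ^ 2 / 2 + 2 * p - t ^ 2) / (t ^ 2 * (1 - p)) by
      rw [eq_div_iff (mul_ne_zero hs0 h1p), hw]; ring]
    repeat' first
      | assumption | exact one_mem _ | exact ofNat_mem _ _
      | apply add_mem | apply sub_mem | apply mul_mem | apply div_mem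
  have hrK : r ∈ divisionField (curveE d) Ω 8 := by
    rw [show r = r * t / t by field_simp]
    exact div_mem hrt htK
  have hd' : (d : Ω) ≠ 0 := Int.cast_ne_zero.mpr hd
  have hr0 : r ≠ 0 := by rintro rfl; apply hd'; rw [← hr]; ring
  refine ⟨hiK, htK, hpK, ?_, hrK⟩
  rw [show w = r * w / r by field_simp]
  exact div_mem hrw hrK

end CurveE

open IntermediateField

/-! ### Quadratic extensions -/

section Quadratic

variable {Ω : Type*} [Field Ω] [Algebra ℚ Ω] {F : IntermediateField ℚ Ω} {s : Ω}

/-- `z` is the square of an element of `F`. -/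
def IsSquareIn (F : IntermediateField ℚ Ω) (z : Ω) : Prop := ∃ x ∈ F, x ^ 2 = z

theorem mem_sup_adjoin_iff (hs : s ^ 2 ∈ F) {z : Ω} :
    z ∈ F ⊔ ℚ⟮s⟯ ↔ ∃ x ∈ F, ∃ y ∈ F, z = x + y * s := by
  have hsInt : IsIntegral F s :=
    ⟨X ^ 2 - C ⟨s ^ 2, hs⟩, monic_X_pow_sub_C _ two_ne_zero, by simp⟩
  rw [← restrictScalars_adjoin_eq_sup, mem_restrictScalars, ← mem_toSubalgebra,
    adjoin_simple_toSubalgebra_of_isAlgebraic hsInt.isAlgebraic]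
  constructor
  · intro h
    induction h using Algebra.adjoin_induction with
    | mem x hx => exact ⟨0, zero_mem _, 1, one_mem _, by simpa using hx⟩
    | algebraMap r => exact ⟨r, r.2, 0, zero_mem _, by simp⟩
    | add z z' _ _ hz hz' =>
      obtain ⟨x, hx, y, hy, rfl⟩ := hz
      obtain ⟨x', hx', y', hy', rfl⟩ := hz'
      exact ⟨x + x', add_mem hx hx', y + y', add_mem hy hy', by ring⟩
    | mul z z' _ _ hz hz' =>
      obtain ⟨x, hx, y, hy, rfl⟩ := hz
      obtain ⟨x', hx', y', hy', rfl⟩ := hz'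
      exact ⟨x * x' + y * y' * s ^ 2, add_mem (mul_mem hx hx') (mul_mem (mul_mem hy hy') hs),
        x * y' + y * x', add_mem (mul_mem hx hy') (mul_mem hy hx'), by ring⟩
  · rintro ⟨x, hx, y, hy, rfl⟩
    exact add_mem (Subalgebra.algebraMap_mem _ (⟨x, hx⟩ : F))
      (mul_mem (Subalgebra.algebraMap_mem _ (⟨y, hy⟩ : F)) (Algebra.self_mem_adjoin_singleton F s))

theorem finrank_sup_adjoin (hs : s ^ 2 ∈ F) (hsF : s ∉ F) :
    Module.finrank ℚ (F ⊔ ℚ⟮s⟯ : IntermediateField ℚ Ω) = 2 * Module.finrank ℚ F := by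
  have heval : aeval s (X ^ 2 - C (⟨s ^ 2, hs⟩ : F)) = 0 := by simp
  have hmonic : (X ^ 2 - C (⟨s ^ 2, hs⟩ : F)).Monic := monic_X_pow_sub_C _ two_ne_zero
  have hsInt : IsIntegral F s := ⟨_, hmonic, heval⟩
  have hdeg : (minpoly F s).natDegree = 2 := by
    apply le_antisymm
    · refine (natDegree_le_natDegree (minpoly.min F s hmonic heval)).trans ?_
      rw [natDegree_X_pow_sub_C]
    · rw [minpoly.two_le_natDegree_iff hsInt]
      rintro ⟨x, rfl⟩
      exact hsF x.2
  have hrank : Module.finrank F F⟮s⟯ = 2 := by rw [adjoin.finrank hsInt, hdeg]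
  have hmul := Module.finrank_mul_finrank ℚ F F⟮s⟯
  rw [← restrictScalars_adjoin_eq_sup, mul_comm, ← hrank]
  exact hmul.symm

theorem eq_zero_of_add_mul_eq_zero (hsF : s ∉ F) {x y : Ω} (hx : x ∈ F) (hy : y ∈ F)
    (h : x + y * s = 0) : x = 0 ∧ y = 0 := by
  have hy0 : y = 0 := by
    by_contra hy0
    apply hsF
    rw [show s = -x / y by rw [eq_div_iff hy0]; linear_combination h]
    exact div_mem (neg_mem hx) hy
  exact ⟨by simpa [hy0] using h, hy0⟩

/-- If `(x + ys)²` lies in `F`, its `s`-coefficient `2xy` vanishes, so the root is `x` or `ys`. -/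
theorem IsSquareIn.of_sup (hs : s ^ 2 ∈ F) (hsF : s ∉ F) {c : Ω} (hc : c ∈ F)
    (h : IsSquareIn (F ⊔ ℚ⟮s⟯) c) : IsSquareIn F c ∨ IsSquareIn F (c * s ^ 2) := by
  have : CharZero Ω := algebraRat.charZero Ω
  obtain ⟨z, hz, rfl⟩ := h
  obtain ⟨x, hx, y, hy, rfl⟩ := (mem_sup_adjoin_iff hs).mp hz
  obtain ⟨-, h2⟩ := eq_zero_of_add_mul_eq_zero hsF (x := x ^ 2 + y ^ 2 * s ^ 2 - (x + y * s) ^ 2)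
    (y := 2 * x * y) (sub_mem (add_mem (pow_mem hx 2) (mul_mem (pow_mem hy 2) hs)) hc)
    (mul_mem (mul_mem (ofNat_mem _ _) hx) hy) (by ring)
  rcases mul_eq_zero.mp h2 with h | rfl
  · right
    obtain rfl : x = 0 := by simpa using h
    exact ⟨y * s ^ 2, mul_mem hy hs, by ring⟩
  · left
    exact ⟨x, hx, by ring⟩

/-- Writing the element as `(a + bs)²`, take `n = a² - b²s²`, the norm of `a + bs`, and `m = a`.
This is the descent step: the norm is a square in `F`, and for a suitable root `n` so is `(x +
n)/2`. -/
theorem IsSquareIn.exists_of_sup (hs : s ^ 2 ∈ F) (hsF : s ∉ F) {x y : Ω} (hx : x ∈ F) (hy : y ∈ F)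
    (h : IsSquareIn (F ⊔ ℚ⟮s⟯) (x + y * s)) :
    ∃ n ∈ F, ∃ m ∈ F, n ^ 2 = x ^ 2 - y ^ 2 * s ^ 2 ∧ 2 * m ^ 2 = x + n := by
  obtain ⟨z, hz, h⟩ := h
  obtain ⟨a, ha, b, hb, rfl⟩ := (mem_sup_adjoin_iff hs).mp hz
  obtain ⟨h1, h2⟩ := eq_zero_of_add_mul_eq_zero hsF (x := x - (a ^ 2 + b ^ 2 * s ^ 2))
    (y := y - 2 * a * b)
    (sub_mem hx (add_mem (pow_mem ha 2) (mul_mem (pow_mem hb 2) hs)))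
    (sub_mem hy (mul_mem (mul_mem (ofNat_mem _ _) ha) hb)) (by linear_combination -h)
  obtain rfl := sub_eq_zero.mp h1
  obtain rfl := sub_eq_zero.mp h2
  exact ⟨a ^ 2 - b ^ 2 * s ^ 2, sub_mem (pow_mem ha 2) (mul_mem (pow_mem hb 2) hs), a, ha,
    by ring, by ring⟩

theorem IsSquareIn.norm_of_sup (hs : s ^ 2 ∈ F) (hsF : s ∉ F) {x y : Ω} (hx : x ∈ F) (hy : y ∈ F)
    (h : IsSquareIn (F ⊔ ℚ⟮s⟯) (x + y * s)) : IsSquareIn F (x ^ 2 - y ^ 2 * s ^ 2) := by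
  obtain ⟨n, hn, -, -, h, -⟩ := h.exists_of_sup hs hsF hx hy
  exact ⟨n, hn, h⟩

theorem IsSquareIn.of_mul {c e : Ω} (he : e ∈ F) (he0 : e ≠ 0) (h : IsSquareIn F (c * e ^ 2)) :
    IsSquareIn F c := by
  obtain ⟨x, hx, hxe⟩ := h
  exact ⟨x / e, div_mem hx he, by rw [div_pow, hxe]; field_simp⟩

end Quadratic

/-! ### The tower of quadratic extensions generated by the torsion -/

namespace CurveE

theorem IsTower.sq_sq {Ω : Type*} [Field Ω] {i t p : Ω} (hT : IsTower i t p) :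
    (t ^ 2) ^ 2 = 2 := by
  rw [← hT.ht]
  ring

variable {Ω : Type*} [Field Ω] [Algebra ℚ Ω]

/-! ### Square classes in the successive layers -/

theorem isSquareIn_bot_iff {q : ℚ} : IsSquareIn ⊥ (q : Ω) ↔ IsSquare q := by
  have : CharZero Ω := algebraRat.charZero Ω
  constructor
  · rintro ⟨x, hx, h⟩
    obtain ⟨y, rfl⟩ := mem_bot.mp hx
    refine ⟨y, ?_⟩
    rw [eq_ratCast] at h
    rw [← sq]
    exact_mod_cast h.symm
  · rintro ⟨y, rfl⟩
    exact ⟨y, mem_bot.mpr ⟨y, by simp⟩, by push_cast; ring⟩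

theorem not_isSquareIn_bot_neg_one : ¬ IsSquareIn ⊥ (-1 : Ω) := by
  have h := isSquareIn_bot_iff (Ω := Ω) (q := -1)
  push_cast at h
  rw [h]
  rintro ⟨y, hy⟩
  nlinarith

theorem not_isSquareIn_bot_neg_two : ¬ IsSquareIn ⊥ (-2 : Ω) := by
  have h := isSquareIn_bot_iff (Ω := Ω) (q := -2)
  push_cast at h
  rw [h]
  rintro ⟨y, hy⟩
  nlinarith

theorem not_isSquareIn_bot_two : ¬ IsSquareIn ⊥ (2 : Ω) := by
  have h := isSquareIn_bot_iff (Ω := Ω) (q := 2)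
  push_cast at h
  rw [h, ← Nat.cast_ofNat, Rat.isSquare_natCast_iff]
  rintro ⟨y, hy⟩
  have : y < 2 := by nlinarith
  interval_cases y <;> omega

/-- The field `ℚ(i)`. -/
def gaussField (i : Ω) : IntermediateField ℚ Ω := ⊥ ⊔ ℚ⟮i⟯

/-- The field `ℚ(i, √2)`, where `√2 = t²`. -/
def cyclotomicField (i t : Ω) : IntermediateField ℚ Ω := gaussField i ⊔ ℚ⟮t ^ 2⟯

/-- The field `ℚ(i, √2, p)`. -/
def octicField (i t p : Ω) : IntermediateField ℚ Ω := cyclotomicField i t ⊔ ℚ⟮p⟯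

/-- The field `ℚ(i, t, p)`. -/
def fourField (i t p : Ω) : IntermediateField ℚ Ω := octicField i t p ⊔ ℚ⟮t⟯

/-- The field `ℚ(i, t, p, w)`. -/
def eightField (i t p w : Ω) : IntermediateField ℚ Ω := fourField i t p ⊔ ℚ⟮w⟯

theorem mem_sup_adjoin_self (F : IntermediateField ℚ Ω) (s : Ω) : s ∈ F ⊔ ℚ⟮s⟯ :=
  (le_sup_right : ℚ⟮s⟯ ≤ F ⊔ ℚ⟮s⟯) (mem_adjoin_simple_self ℚ s)

variable {i t p w : Ω}

theorem i_notMem (hi : i ^ 2 = -1) : i ∉ (⊥ : IntermediateField ℚ Ω) :=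
  fun h => not_isSquareIn_bot_neg_one ⟨i, h, hi⟩

theorem i_sq_mem (hi : i ^ 2 = -1) (F : IntermediateField ℚ Ω) : i ^ 2 ∈ F :=
  hi ▸ neg_mem (one_mem _)

theorem isSquareIn_gaussField (hi : i ^ 2 = -1) {c : Ω} (hc : c ∈ (⊥ : IntermediateField ℚ Ω))
    (h : IsSquareIn (gaussField i) c) : IsSquareIn ⊥ c ∨ IsSquareIn ⊥ (-c) := by
  have := h.of_sup (i_sq_mem hi _) (i_notMem hi) hc
  rwa [hi, mul_neg_one] at this

theorem not_isSquareIn_gaussField_two (hi : i ^ 2 = -1) : ¬ IsSquareIn (gaussField i) 2 := by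
  intro h
  rcases isSquareIn_gaussField hi (ofNat_mem _ _) h with h | h
  exacts [not_isSquareIn_bot_two h, not_isSquareIn_bot_neg_two h]

theorem not_isSquareIn_gaussField_neg_two (hi : i ^ 2 = -1) :
    ¬ IsSquareIn (gaussField i) (-2) := by
  intro h
  rcases isSquareIn_gaussField hi (neg_mem (ofNat_mem _ _)) h with h | h
  · exact not_isSquareIn_bot_neg_two h
  · rw [neg_neg] at h
    exact not_isSquareIn_bot_two h

theorem IsTower.sq_sq_mem (hT : IsTower i t p) (F : IntermediateField ℚ Ω) : (t ^ 2) ^ 2 ∈ F :=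
  hT.sq_sq ▸ ofNat_mem _ _

theorem IsTower.sq_notMem (hT : IsTower i t p) : t ^ 2 ∉ gaussField i :=
  fun h => not_isSquareIn_gaussField_two hT.hi ⟨_, h, hT.sq_sq⟩

theorem IsTower.not_isSquareIn_sqrt_two (hT : IsTower i t p) {e : Ω} (he : e ∈ gaussField i)
    (he0 : e ≠ 0) : ¬ IsSquareIn (cyclotomicField i t) (e * t ^ 2) := by
  intro h
  have := IsSquareIn.norm_of_sup (hT.sq_sq_mem _) hT.sq_notMem (zero_mem _) he
    (by rwa [zero_add])
  rw [hT.sq_sq, show (0 : Ω) ^ 2 - e ^ 2 * 2 = -2 * e ^ 2 by ring] at this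
  exact not_isSquareIn_gaussField_neg_two hT.hi (this.of_mul he he0)

theorem IsTower.not_isSquareIn_sqrt_two_mul (hT : IsTower i t p) {e : Ω} (he : e ∈ gaussField i)
    (he0 : e ≠ 0) : ¬ IsSquareIn (cyclotomicField i t) (e * (2 + t ^ 2)) := by
  intro h
  have := IsSquareIn.norm_of_sup (x := e * 2) (hT.sq_sq_mem _) hT.sq_notMem
    (mul_mem he (ofNat_mem _ _)) he (by rwa [← mul_add])
  rw [hT.sq_sq, show (e * 2) ^ 2 - e ^ 2 * 2 = 2 * e ^ 2 by ring] at this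
  exact not_isSquareIn_gaussField_two hT.hi (this.of_mul he he0)

/-- The norm of `e(1 + √2)` to `ℚ(i)` is `-e²`, with roots `±ei`. So one of `e(1 ± i)/2` would be a
square in `ℚ(i)`, and its norm `2(e/2)²` a square in `ℚ`. -/
theorem IsTower.not_isSquareIn_one_add (hT : IsTower i t p) {e : Ω}
    (he : e ∈ (⊥ : IntermediateField ℚ Ω)) (he0 : e ≠ 0) :
    ¬ IsSquareIn (cyclotomicField i t) (e * (1 + t ^ 2)) := by
  have : CharZero Ω := algebraRat.charZero Ω
  intro h
  have heG : e ∈ gaussField i := (le_sup_left : (⊥ : IntermediateField ℚ Ω) ≤ gaussField i) he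
  have hiG : i ∈ gaussField i := mem_sup_adjoin_self _ _
  obtain ⟨n, hn, m, hm, hnm, hm2⟩ := IsSquareIn.exists_of_sup (x := e) (hT.sq_sq_mem _)
    hT.sq_notMem heG heG (by rwa [mul_add, mul_one] at h)
  have hi := hT.hi
  obtain ⟨ε, hε, rfl⟩ : ∃ ε : Ω, (ε = 1 ∨ ε = -1) ∧ n = ε * e * i := by
    have : (n - e * i) * (n + e * i) = 0 := by
      rw [hT.sq_sq] at hnm
      linear_combination hnm - e ^ 2 * hi
    rcases mul_eq_zero.mp this with h | h
    · exact ⟨1, .inl rfl, by linear_combination h⟩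
    · exact ⟨-1, .inr rfl, by linear_combination h⟩
  have hεm : ε ∈ (⊥ : IntermediateField ℚ Ω) := by
    rcases hε with rfl | rfl
    exacts [one_mem _, neg_mem (one_mem _)]
  have h2 : (2 : Ω) ∈ (⊥ : IntermediateField ℚ Ω) := ofNat_mem _ _
  have := IsSquareIn.norm_of_sup (F := ⊥) (s := i) (x := e / 2) (y := ε * e / 2) (i_sq_mem hi _)
    (i_notMem hi) (div_mem he h2) (div_mem (mul_mem hεm he) h2)
    ⟨m, hm, by linear_combination hm2 / 2⟩
  rw [show (e / 2) ^ 2 - (ε * e / 2) ^ 2 * i ^ 2 = 2 * (e / 2) ^ 2 by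
    rcases hε with rfl | rfl <;> rw [hi] <;> ring] at this
  exact not_isSquareIn_bot_two (this.of_mul (div_mem he h2) (div_ne_zero he0 two_ne_zero))

theorem i_mem_cyclotomicField : i ∈ cyclotomicField i t :=
  (le_sup_left : gaussField i ≤ cyclotomicField i t) (mem_sup_adjoin_self _ _)

theorem sq_mem_cyclotomicField : t ^ 2 ∈ cyclotomicField i t := mem_sup_adjoin_self _ _

theorem bot_mem {e : Ω} (he : e ∈ (⊥ : IntermediateField ℚ Ω)) (F : IntermediateField ℚ Ω) :
    e ∈ F := (bot_le : ⊥ ≤ F) he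

theorem IsTower.p_sq_mem (hT : IsTower i t p) {F : IntermediateField ℚ Ω} (ht : t ^ 2 ∈ F) :
    p ^ 2 ∈ F := hT.hp ▸ add_mem (one_mem _) ht

theorem IsTower.p_notMem (hT : IsTower i t p) : p ∉ cyclotomicField i t := fun h =>
  hT.not_isSquareIn_one_add (one_mem _) one_ne_zero ⟨p, h, by rw [hT.hp, one_mul]⟩

theorem IsTower.isSquareIn_octicField (hT : IsTower i t p) {c : Ω} (hc : c ∈ cyclotomicField i t)
    (h : IsSquareIn (octicField i t p) c) :
    IsSquareIn (cyclotomicField i t) c ∨ IsSquareIn (cyclotomicField i t) (c * (1 + t ^ 2)) := by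
  have := h.of_sup (hT.p_sq_mem sq_mem_cyclotomicField) hT.p_notMem hc
  rwa [hT.hp] at this

/-- Descending through `p` leaves `e√2` or `e√2(1 + √2) = e(2 + √2)`; their norms to `ℚ(i)` are
`-2e²` and `2e²`, neither a square there. -/
theorem IsTower.not_isSquareIn_octicField (hT : IsTower i t p) {e : Ω}
    (he : e ∈ (⊥ : IntermediateField ℚ Ω)) (he0 : e ≠ 0) :
    ¬ IsSquareIn (octicField i t p) (e * t ^ 2) := by
  intro h
  rcases hT.isSquareIn_octicField (mul_mem (bot_mem he _) sq_mem_cyclotomicField) h with h | h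
  · exact hT.not_isSquareIn_sqrt_two (bot_mem he _) he0 h
  · apply hT.not_isSquareIn_sqrt_two_mul (bot_mem he _) he0
    rwa [show e * (2 + t ^ 2) = e * t ^ 2 * (1 + t ^ 2) by linear_combination -e * hT.ht]

theorem sq_mem_octicField : t ^ 2 ∈ octicField i t p :=
  (le_sup_left : cyclotomicField i t ≤ octicField i t p) sq_mem_cyclotomicField

theorem p_mem_octicField : p ∈ octicField i t p := mem_sup_adjoin_self _ _

theorem IsTower.t_notMem (hT : IsTower i t p) : t ∉ octicField i t p := fun h =>
  hT.not_isSquareIn_octicField (one_mem _) one_ne_zero ⟨t, h, by rw [one_mul]⟩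

/-- The layers `t` and `p` make no new rational number a square; only `√2` and `i` contribute,
giving the classes `±1, ±2`. -/
theorem IsTower.isSquareIn_fourField (hT : IsTower i t p) {e : Ω}
    (he : e ∈ (⊥ : IntermediateField ℚ Ω)) (he0 : e ≠ 0) (h : IsSquareIn (fourField i t p) e) :
    IsSquareIn (⊥ : IntermediateField ℚ Ω) e ∨ IsSquareIn (⊥ : IntermediateField ℚ Ω) (-e) ∨
      IsSquareIn (⊥ : IntermediateField ℚ Ω) (e * 2) ∨
      IsSquareIn (⊥ : IntermediateField ℚ Ω) (-(e * 2)) := by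
  rcases h.of_sup sq_mem_octicField hT.t_notMem (bot_mem he _) with h | h
  swap
  · exact absurd h (hT.not_isSquareIn_octicField he he0)
  rcases hT.isSquareIn_octicField (bot_mem he _) h with h | h
  swap
  · exact absurd h (hT.not_isSquareIn_one_add he he0)
  rcases h.of_sup (hT.sq_sq_mem _) hT.sq_notMem (bot_mem he _) with h | h
  · rcases isSquareIn_gaussField hT.hi he h with h | h
    exacts [.inl h, .inr (.inl h)]
  · rw [hT.sq_sq] at h
    rcases isSquareIn_gaussField hT.hi (mul_mem he (ofNat_mem _ _)) h with h | h
    exacts [.inr (.inr (.inl h)), .inr (.inr (.inr h))]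

/-- The norm of `ew²` down the layer `t` is `8e² = (2e√2)²`. The two signs of its root leave `2ep`
or `2e(p - √2)` as a square; the norm of either down the layer `p` is `1 + √2` times a nonzero
square in `ℚ(i, √2)`, and `1 + √2` is not a square there. The factor `e` is kept so that the result
also handles `dw²`. -/
theorem IsTower.not_isSquareIn_top (hT : IsTower i t p) (hw : IsLastGen t p w) {e : Ω}
    (he : e ∈ (⊥ : IntermediateField ℚ Ω)) (he0 : e ≠ 0) :
    ¬ IsSquareIn (fourField i t p) (e * w ^ 2) := by
  have : CharZero Ω := algebraRat.charZero Ω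
  intro h
  rw [IsLastGen] at hw
  have hp := hT.hp
  have ht := hT.ht
  have hi := hT.hi
  have heO : e ∈ octicField i t p := bot_mem he _
  have hsO : t ^ 2 ∈ octicField i t p := sq_mem_octicField
  have hpO : p ∈ octicField i t p := p_mem_octicField
  have heC : e ∈ cyclotomicField i t := bot_mem he _
  have hsC : t ^ 2 ∈ cyclotomicField i t := sq_mem_cyclotomicField
  have hiC : i ∈ cyclotomicField i t := i_mem_cyclotomicField
  have h1 := hT.not_isSquareIn_one_add (one_mem _) one_ne_zero
  rw [one_mul] at h1
  have hs1 : 1 - t ^ 2 ≠ 0 := by grind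
  have hi0 : i ≠ 0 := by grind
  obtain ⟨n, hn, m, hm, hnm, hm2⟩ := IsSquareIn.exists_of_sup (F := octicField i t p) (s := t)
    (x := e * (4 * p - 2 * t ^ 2)) (y := e * (-2 * t ^ 2 * (1 - p))) hsO hT.t_notMem
    (mul_mem heO (sub_mem (mul_mem (ofNat_mem _ _) hpO) (mul_mem (ofNat_mem _ _) hsO)))
    (mul_mem heO (mul_mem (mul_mem (neg_mem (ofNat_mem _ _)) hsO) (sub_mem (one_mem _) hpO)))
    (by
      rw [hw, show e * (4 * p - 2 * t ^ 2 - 2 * t ^ 3 * (1 - p)) =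
        e * (4 * p - 2 * t ^ 2) + e * (-2 * t ^ 2 * (1 - p)) * t by ring] at h
      exact h)
  have hn' : (n - 2 * e * t ^ 2) * (n + 2 * e * t ^ 2) = 0 := by grind
  rcases mul_eq_zero.mp hn' with h | h
  · have := IsSquareIn.norm_of_sup (x := 0) (y := 2 * e) (hT.p_sq_mem hsC) hT.p_notMem (zero_mem _)
      (mul_mem (ofNat_mem _ _) heC) ⟨m, hm, by linear_combination hm2 / 2 + h / 2⟩
    rw [hp, show (0 : Ω) ^ 2 - (2 * e) ^ 2 * (1 + t ^ 2) = (1 + t ^ 2) * (2 * e * i) ^ 2 by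
      linear_combination -4 * e ^ 2 * (1 + t ^ 2) * hi] at this
    exact h1 (this.of_mul (mul_mem (mul_mem (ofNat_mem _ _) heC) hiC)
      (mul_ne_zero (mul_ne_zero two_ne_zero he0) hi0))
  · have := IsSquareIn.norm_of_sup (x := -2 * e * t ^ 2) (y := 2 * e) (hT.p_sq_mem hsC) hT.p_notMem
      (mul_mem (mul_mem (neg_mem (ofNat_mem _ _)) heC) hsC)
      (mul_mem (ofNat_mem _ _) heC) ⟨m, hm, by linear_combination hm2 / 2 + h / 2⟩
    rw [hp, show (-2 * e * t ^ 2) ^ 2 - (2 * e) ^ 2 * (1 + t ^ 2) =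
      (1 + t ^ 2) * (2 * e * i * (1 - t ^ 2)) ^ 2 by grind] at this
    exact h1 (this.of_mul (mul_mem (mul_mem (mul_mem (ofNat_mem _ _) heC) hiC)
      (sub_mem (one_mem _) hsC)) (mul_ne_zero (mul_ne_zero (mul_ne_zero two_ne_zero he0) hi0) hs1))

theorem IsTower.w_notMem (hT : IsTower i t p) (hw : IsLastGen t p w) : w ∉ fourField i t p :=
  fun h => hT.not_isSquareIn_top hw (one_mem _) one_ne_zero ⟨w, h, by rw [one_mul]⟩

theorem IsLastGen.sq_mem (hw : IsLastGen t p w) {F : IntermediateField ℚ Ω} (ht : t ∈ F)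
    (hp : p ∈ F) : w ^ 2 ∈ F := by
  rw [IsLastGen] at hw
  rw [hw]
  repeat' first
    | assumption | exact one_mem _ | exact ofNat_mem _ _
    | apply sub_mem | apply mul_mem | apply pow_mem

/-! ### Degrees of the tower, and when it contains `√d` -/

theorem finrank_gaussField (hi : i ^ 2 = -1) : Module.finrank ℚ (gaussField i) = 2 := by
  rw [gaussField, finrank_sup_adjoin (i_sq_mem hi _) (i_notMem hi), IntermediateField.finrank_bot]

theorem IsTower.finrank_octicField (hT : IsTower i t p) :
    Module.finrank ℚ (octicField i t p) = 8 := by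
  rw [octicField, finrank_sup_adjoin (hT.p_sq_mem sq_mem_cyclotomicField) hT.p_notMem,
    cyclotomicField, finrank_sup_adjoin (hT.sq_sq_mem _) hT.sq_notMem, finrank_gaussField hT.hi]

theorem IsTower.finrank_eightField (hT : IsTower i t p) (hw : IsLastGen t p w) :
    Module.finrank ℚ (eightField i t p w) = 32 := by
  rw [eightField, finrank_sup_adjoin (F := fourField i t p)
    (IsLastGen.sq_mem hw (mem_sup_adjoin_self _ _)
    ((le_sup_left : octicField i t p ≤ fourField i t p) p_mem_octicField)) (hT.w_notMem hw),
    fourField, finrank_sup_adjoin sq_mem_octicField hT.t_notMem, hT.finrank_octicField]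

theorem IsTower.finrank_octicField_sup (hT : IsTower i t p) {d : ℤ} (hd : d ≠ 0) {r : Ω}
    (hr : r ^ 2 = d) :
    Module.finrank ℚ (octicField i t p ⊔ ℚ⟮r * t⟯ : IntermediateField ℚ Ω) = 16 := by
  have : CharZero Ω := algebraRat.charZero Ω
  have hrt : (r * t) ^ 2 = d * t ^ 2 := by rw [mul_pow, hr]
  rw [finrank_sup_adjoin (hrt ▸ mul_mem (intCast_mem _ _) sq_mem_octicField), hT.finrank_octicField]
  exact fun h => hT.not_isSquareIn_octicField (intCast_mem _ d) (Int.cast_ne_zero.mpr hd)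
    ⟨_, h, hrt⟩

theorem eq_of_isSquareIn_bot {d : ℤ} (hd : Squarefree d)
    (h : IsSquareIn (⊥ : IntermediateField ℚ Ω) (d : Ω) ∨
      IsSquareIn (⊥ : IntermediateField ℚ Ω) (-(d : Ω)) ∨
      IsSquareIn (⊥ : IntermediateField ℚ Ω) ((d : Ω) * 2) ∨
      IsSquareIn (⊥ : IntermediateField ℚ Ω) (-((d : Ω) * 2))) :
    d = 1 ∨ d = -1 ∨ d = 2 ∨ d = -2 := by
  have : CharZero Ω := algebraRat.charZero Ω
  have key : ∀ n : ℤ, IsSquareIn (⊥ : IntermediateField ℚ Ω) (n : Ω) → ∃ k : ℤ, n = k * k := by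
    intro n hn
    have h := (isSquareIn_bot_iff (Ω := Ω) (q := n)).mp (by simpa using hn)
    rwa [Rat.isSquare_intCast_iff] at h
  have hunit : ∀ k : ℤ, k * k ∣ d → k * k = 1 := by
    intro k hk
    rcases Int.isUnit_iff.mp (hd k hk) with rfl | rfl <;> rfl
  -- If `2n` is a square then `n` is twice a square; this reduces the classes `±2` to the squarefree
  -- condition on `d`.
  have hev : ∀ k n : ℤ, n * 2 = k * k → ∃ l, n = 2 * (l * l) := by
    intro k n h
    have : 2 ∣ k := Int.prime_two.dvd_of_dvd_pow (n := 2) ⟨n, by linarith [sq k]⟩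
    obtain ⟨l, rfl⟩ := this
    exact ⟨l, by linarith⟩
  rcases h with h | h | h | h
  · obtain ⟨k, hk⟩ := key d h
    have := hunit k ⟨1, by linarith⟩
    omega
  · obtain ⟨k, hk⟩ := key (-d) (by push_cast; exact h)
    have := hunit k ⟨-1, by linarith⟩
    omega
  · obtain ⟨k, hk⟩ := key (d * 2) (by push_cast; exact h)
    obtain ⟨l, hl⟩ := hev k d hk
    have := hunit l ⟨2, by linarith⟩
    omega
  · obtain ⟨k, hk⟩ := key (-d * 2) (by push_cast; rw [neg_mul]; exact h)
    obtain ⟨l, hl⟩ := hev k (-d) hk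
    have := hunit l ⟨-2, by linarith⟩
    omega

theorem IsTower.mem_eightField_iff (hT : IsTower i t p) (hw : IsLastGen t p w) {d : ℤ}
    (hd : Squarefree d) {r : Ω} (hr : r ^ 2 = d) :
    r ∈ eightField i t p w ↔ d = 1 ∨ d = -1 ∨ d = 2 ∨ d = -2 := by
  have : CharZero Ω := algebraRat.charZero Ω
  have hd0 : (d : Ω) ≠ 0 := Int.cast_ne_zero.mpr hd.ne_zero
  have hpF : p ∈ fourField i t p :=
    (le_sup_left : octicField i t p ≤ fourField i t p) p_mem_octicField
  constructor
  · intro h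
    have hsq : IsSquareIn (eightField i t p w) (d : Ω) := ⟨r, h, hr⟩
    rcases hsq.of_sup (IsLastGen.sq_mem hw (mem_sup_adjoin_self _ _) hpF) (hT.w_notMem hw)
      (intCast_mem _ _) with h | h
    · exact eq_of_isSquareIn_bot hd (hT.isSquareIn_fourField (intCast_mem _ _) hd0 h)
    · exact absurd h (hT.not_isSquareIn_top hw (intCast_mem _ _) hd0)
  · have hle : cyclotomicField i t ≤ eightField i t p w :=
      le_sup_left.trans (le_sup_left.trans (le_sup_left : fourField i t p ≤ eightField i t p w))
    have hiE : i ∈ eightField i t p w := hle i_mem_cyclotomicField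
    have hsE : t ^ 2 ∈ eightField i t p w := hle sq_mem_cyclotomicField
    have key : ∀ z ∈ eightField i t p w, z ^ 2 = d → r ∈ eightField i t p w := by
      intro z hz hzd
      rcases sq_eq_sq_iff_eq_or_eq_neg.mp (hr.trans hzd.symm) with rfl | rfl
      exacts [hz, neg_mem hz]
    have hi := hT.hi
    have hs := hT.sq_sq
    rintro (rfl | rfl | rfl | rfl)
    · exact key 1 (one_mem _) (by simp)
    · exact key i hiE (by simp [hi])
    · exact key (t ^ 2) hsE (by simp [hs])
    · exact key (i * t ^ 2) (mul_mem hiE hsE) (by rw [mul_pow, hi, hs]; simp)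

/-- The layers `p` and `t` in the other order: `1` and `p` remain independent over `ℚ(i, t)`, which
lets coefficients of `p` be compared in `IsExpressed.unique`. -/
theorem IsTower.p_notMem_sup (hT : IsTower i t p) : p ∉ cyclotomicField i t ⊔ ℚ⟮t⟯ := by
  intro h
  have ht : t ∉ cyclotomicField i t := fun h =>
    hT.t_notMem ((le_sup_left : cyclotomicField i t ≤ octicField i t p) h)
  have hsq : IsSquareIn (cyclotomicField i t ⊔ ℚ⟮t⟯) (1 + t ^ 2) := ⟨p, h, hT.hp⟩
  rcases hsq.of_sup sq_mem_cyclotomicField ht (add_mem (one_mem _) sq_mem_cyclotomicField)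
    with h | h
  · exact hT.not_isSquareIn_one_add (one_mem _) one_ne_zero (by rwa [one_mul])
  · apply hT.not_isSquareIn_sqrt_two_mul (one_mem _) one_ne_zero
    rwa [show 1 * (2 + t ^ 2) = (1 + t ^ 2) * t ^ 2 by linear_combination -hT.ht]

end CurveE

/-! ### The roots of `f8` -/

namespace CurveE

section Descent

variable {R : Type*} [CommRing R]

/-- The norm of `y - η + g - W` to `ℚ(i, κ)` is `partA + partB * i + (partC + partD * i) * κ`.
Here `κ² = -2`, `η² = κ`, `g² = -1 - iκ` and `2β + 1 = η - g + W` for a root `β` of `f8`. -/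
def partA (y : R) : R :=
  y ^ 8 + 4 * y ^ 6 - 16 * y ^ 5 - 50 * y ^ 4 + 224 * y ^ 3 + 84 * y ^ 2 - 80 * y - 167

/-- The coefficient of `i`; see `partA`. -/
def partB (y : R) : R :=
  32 * y ^ 5 - 64 * y ^ 4 - 64 * y ^ 3 + 128 * y ^ 2 + 32 * y + 192

/-- The coefficient of `κ`; see `partA`. -/
def partC (y : R) : R :=
  -16 * y ^ 5 + 48 * y ^ 4 + 32 * y ^ 3 - 224 * y ^ 2 - 16 * y + 176

/-- The coefficient of `iκ`; see `partA`. -/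
def partD (y : R) : R :=
  8 * y ^ 6 - 56 * y ^ 4 + 128 * y ^ 3 + 88 * y ^ 2 - 128 * y - 40

/-- The real part of the norm to `ℚ(i)`. -/
def partRe (y : R) : R := partA y ^ 2 - partB y ^ 2 + 2 * partC y ^ 2 - 2 * partD y ^ 2

/-- The imaginary part of the norm to `ℚ(i)`. -/
def partIm (y : R) : R := 2 * partA y * partB y + 4 * partC y * partD y

/-- The norm to `ℚ(i, η)` is `partU + η * partV`. -/
def partU (y i κ : R) : R :=
  y ^ 4 + 4 * y ^ 2 * i * κ + 8 * y ^ 2 * κ + 2 * y ^ 2 - 8 * y * κ + 8 * y + 4 * i * κ - 8 * κ - 11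

/-- The coefficient of `η`; see `partU`. -/
def partV (y i κ : R) : R :=
  -4 * y ^ 3 - 2 * y ^ 2 * i * κ + 2 * y ^ 2 * κ - 4 * y * i * κ - 8 * y * i - 4 * y * κ + 4 * y
    + 6 * i * κ + 8 * i + 2 * κ

/-- The norm to `ℚ(i, η, g)` is `partX + g * partY`. -/
def partX (y i κ η : R) : R := y ^ 2 - 1 + 2 * κ + η * (-2 * y + (1 - i) * κ)

/-- The coefficient of `g`; see `partX`. -/
def partY (y i κ η : R) : R := 2 * y + 2 * i + η * (-2 + (1 + i) * κ)

/-- The last norm, from `ℚ(i)` to `ℚ`, is monic of degree 32 in `y = 2β + 1`, whence the factor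
`2³²`. -/
theorem partRe_sq_add_partIm_sq {Ω : Type*} [Field Ω] [Algebra ℚ Ω] (β : Ω) :
    partRe (2 * β + 1) ^ 2 + partIm (2 * β + 1) ^ 2 = 2 ^ 32 * aeval β f8 := by
  simp only [f8, map_add, map_sub, map_mul, map_pow, aeval_X, map_ofNat, map_one]
  simp only [partRe, partIm, partA, partB, partC, partD]
  ring

theorem norm_gauss {y i : R} (hi : i ^ 2 = -1) :
    (partA y + partB y * i) ^ 2 + 2 * (partC y + partD y * i) ^ 2 = partRe y + i * partIm y := by
  rw [partRe, partIm]
  linear_combination (partB y ^ 2 + 2 * partD y ^ 2) * hi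

theorem norm_kappa {y i κ : R} (hi : i ^ 2 = -1) (hκ : κ ^ 2 = -2) :
    partU y i κ ^ 2 - κ * partV y i κ ^ 2 =
      partA y + partB y * i + κ * (partC y + partD y * i) := by
  simp only [partU, partV, partA, partB, partC, partD]
  grind

theorem norm_eta {y i κ η : R} (hi : i ^ 2 = -1) (hκ : κ ^ 2 = -2) (hη : η ^ 2 = κ) :
    partX y i κ η ^ 2 - (-1 - i * κ) * partY y i κ η ^ 2 = partU y i κ + η * partV y i κ := by
  simp only [partU, partV, partX, partY]
  grind

end Descent

/-- A vanishing norm means that one of the two conjugate factors vanishes; the sign of the square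
root is chosen to make it the one with `+`. -/
theorem exists_sq_eq_add_mul_eq_zero {Ω : Type*} [Field Ω] [IsAlgClosed Ω] {a b c : Ω}
    (h : a ^ 2 - c * b ^ 2 = 0) : ∃ e, e ^ 2 = c ∧ a + e * b = 0 := by
  obtain ⟨e, rfl⟩ := IsAlgClosed.exists_pow_nat_eq c two_pos
  rcases mul_eq_zero.mp (show (a + e * b) * (a - e * b) = 0 by linear_combination h) with h | h
  · exact ⟨e, rfl, h⟩
  · exact ⟨-e, by ring, by linear_combination h⟩

/-! ### The tower attached to a root of `f8` -/

variable {Ω : Type*} [Field Ω]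

/-- The root `β` of `f8` with `2β + 1 = y` is expressed through the tower. -/
structure IsExpressed (y i t p : Ω) : Prop extends IsTower i t p where
  eq : (y - ((i - 1) * t ^ 3 / 2 - i * p)) ^ 2 = 2 * p - 2 * t + 2 * t * p - t ^ 2 + i * t ^ 2

/-- Under `t = (1-i)κη/2` and `p = -ig` one has `t² = iκ`, `η = (i-1)t³/2` and `g = ip`. Then `partX
+ g * partY` is `(y - η + g)²` minus the radicand in `IsExpressed`. -/
theorem IsExpressed.of_partX [CharZero Ω] {y i κ η g : Ω} (hi : i ^ 2 = -1) (hκ : κ ^ 2 = -2)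
    (hη : η ^ 2 = κ)
    (hg : g ^ 2 = -1 - i * κ) (h : partX y i κ η + g * partY y i κ η = 0) :
    IsExpressed y i ((1 - i) * κ * η / 2) (-i * g) := by
  have hT : IsTower i ((1 - i) * κ * η / 2) (-i * g) := by
    clear h
    exact ⟨hi, by grind, by grind⟩
  refine ⟨hT, ?_⟩
  have h1 : (i - 1) * ((1 - i) * κ * η / 2) ^ 3 / 2 = η := by clear h; grind
  have h2 : ((1 - i) * κ * η / 2) ^ 2 = i * κ := by clear h; grind
  rw [h1, h2, ← sub_eq_zero, ← h, partX, partY]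
  clear h h1 h2 hT
  grind

/-- The factor by which the last generators of the two descriptions of the field differ. -/
def topFactor (i t p : Ω) : Ω :=
  (-p - i * p + i * t + i * t * p - i * t ^ 2 + i * t ^ 2 * p - i * t ^ 3 * p) / 2

/-- The inverse of `topFactor`. -/
def topFactorInv (i t p : Ω) : Ω :=
  (-2 + 2 * p + 2 * t + 2 * t * p + t ^ 2 - 3 * t ^ 2 * p - t ^ 3 - 2 * t ^ 3 * p - 4 * i * p
    - 2 * i * t + i * t ^ 2 + 3 * i * t ^ 2 * p + i * t ^ 3) / 4

theorem IsTower.topFactor_mul [CharZero Ω] {i t p : Ω} (hT : IsTower i t p) :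
    topFactor i t p * topFactorInv i t p = 1 := by
  obtain ⟨hi, ht, hp⟩ := hT
  rw [topFactor, topFactorInv]
  grind

/-- The radicand in `IsExpressed` is the square of `topFactor` times the radicand of `w`, so both
square roots generate the same extension of `ℚ(i, t, p)`. -/
theorem IsExpressed.isLastGen [CharZero Ω] {y i t p : Ω} (h : IsExpressed y i t p) :
    IsLastGen t p (topFactorInv i t p * (y - ((i - 1) * t ^ 3 / 2 - i * p))) := by
  obtain ⟨⟨hi, ht, hp⟩, h⟩ := h
  rw [IsLastGen, mul_pow, h, topFactorInv]
  clear h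
  grind

theorem exists_gamma [IsAlgClosed Ω] {y i κ η : Ω} (hi : i ^ 2 = -1)
    (hκ : κ ^ 2 = -2) (hη : η ^ 2 = κ) (h : partU y i κ + η * partV y i κ = 0) :
    ∃ g, g ^ 2 = -1 - i * κ ∧ partX y i κ η + g * partY y i κ η = 0 :=
  exists_sq_eq_add_mul_eq_zero (by rw [norm_eta hi hκ hη, h])

theorem exists_eta [IsAlgClosed Ω] {y i κ : Ω} (hi : i ^ 2 = -1) (hκ : κ ^ 2 = -2)
    (h : partA y + partB y * i + κ * (partC y + partD y * i) = 0) :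
    ∃ η, η ^ 2 = κ ∧ partU y i κ + η * partV y i κ = 0 :=
  exists_sq_eq_add_mul_eq_zero (by rw [norm_kappa hi hκ, h])

theorem exists_kappa [IsAlgClosed Ω] {y i : Ω} (hi : i ^ 2 = -1)
    (h : partRe y + i * partIm y = 0) :
    ∃ κ, κ ^ 2 = -2 ∧ partA y + partB y * i + κ * (partC y + partD y * i) = 0 :=
  exists_sq_eq_add_mul_eq_zero (by rw [← h, ← norm_gauss hi]; ring)

variable [Algebra ℚ Ω]

theorem i_mem_fourField {i t p : Ω} : i ∈ fourField i t p :=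
  (le_sup_left.trans le_sup_left : cyclotomicField i t ≤ fourField i t p) i_mem_cyclotomicField

theorem t_mem_fourField {i t p : Ω} : t ∈ fourField i t p := mem_sup_adjoin_self _ _

theorem p_mem_fourField {i t p : Ω} : p ∈ fourField i t p :=
  (le_sup_left : octicField i t p ≤ fourField i t p) p_mem_octicField

section Membership

variable {K : IntermediateField ℚ Ω} {y i t p κ η : Ω}

theorem partA_mem (hy : y ∈ K) : partA y ∈ K := by
  rw [partA]
  repeat' first
    | assumption | exact one_mem _ | exact ofNat_mem _ _
    | apply add_mem | apply sub_mem | apply mul_mem | apply pow_mem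

theorem partB_mem (hy : y ∈ K) : partB y ∈ K := by
  rw [partB]
  repeat' first
    | assumption | exact one_mem _ | exact ofNat_mem _ _
    | apply add_mem | apply sub_mem | apply mul_mem | apply pow_mem

theorem partC_mem (hy : y ∈ K) : partC y ∈ K := by
  rw [partC]
  repeat' first
    | assumption | exact one_mem _ | exact ofNat_mem _ _
    | apply add_mem | apply sub_mem | apply mul_mem | apply pow_mem | apply neg_mem

theorem partD_mem (hy : y ∈ K) : partD y ∈ K := by
  rw [partD]
  repeat' first
    | assumption | exact one_mem _ | exact ofNat_mem _ _
    | apply add_mem | apply sub_mem | apply mul_mem | apply pow_mem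

theorem partRe_mem (hy : y ∈ K) : partRe y ∈ K :=
  sub_mem (add_mem (sub_mem (pow_mem (partA_mem hy) 2) (pow_mem (partB_mem hy) 2))
    (mul_mem (ofNat_mem _ _) (pow_mem (partC_mem hy) 2)))
    (mul_mem (ofNat_mem _ _) (pow_mem (partD_mem hy) 2))

theorem partIm_mem (hy : y ∈ K) : partIm y ∈ K :=
  add_mem (mul_mem (mul_mem (ofNat_mem _ _) (partA_mem hy)) (partB_mem hy))
    (mul_mem (mul_mem (ofNat_mem _ _) (partC_mem hy)) (partD_mem hy))

theorem partU_mem (hy : y ∈ K) (hi : i ∈ K) (hκ : κ ∈ K) : partU y i κ ∈ K := by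
  rw [partU]
  repeat' first
    | assumption | exact one_mem _ | exact ofNat_mem _ _
    | apply add_mem | apply sub_mem | apply mul_mem | apply pow_mem

theorem partV_mem (hy : y ∈ K) (hi : i ∈ K) (hκ : κ ∈ K) : partV y i κ ∈ K := by
  rw [partV]
  repeat' first
    | assumption | exact one_mem _ | exact ofNat_mem _ _
    | apply add_mem | apply sub_mem | apply mul_mem | apply pow_mem | apply neg_mem

theorem partX_mem (hy : y ∈ K) (hi : i ∈ K) (hκ : κ ∈ K) (hη : η ∈ K) :
    partX y i κ η ∈ K := by
  rw [partX]
  repeat' first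
    | assumption | exact one_mem _ | exact ofNat_mem _ _
    | apply add_mem | apply sub_mem | apply mul_mem | apply pow_mem | apply neg_mem

theorem partY_mem (hy : y ∈ K) (hi : i ∈ K) (hκ : κ ∈ K) (hη : η ∈ K) :
    partY y i κ η ∈ K := by
  rw [partY]
  repeat' first
    | assumption | exact one_mem _ | exact ofNat_mem _ _
    | apply add_mem | apply sub_mem | apply mul_mem | apply pow_mem | apply neg_mem

theorem topFactor_mem (hi : i ∈ K) (ht : t ∈ K) (hp : p ∈ K) : topFactor i t p ∈ K := by
  rw [topFactor]
  repeat' first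
    | assumption | exact one_mem _ | exact ofNat_mem _ _
    | apply add_mem | apply sub_mem | apply mul_mem | apply pow_mem | apply neg_mem | apply div_mem

theorem topFactorInv_mem (hi : i ∈ K) (ht : t ∈ K) (hp : p ∈ K) : topFactorInv i t p ∈ K := by
  rw [topFactorInv]
  repeat' first
    | assumption | exact one_mem _ | exact ofNat_mem _ _
    | apply add_mem | apply sub_mem | apply mul_mem | apply pow_mem | apply neg_mem | apply div_mem

theorem shift_mem (hi : i ∈ K) (ht : t ∈ K) (hp : p ∈ K) : (i - 1) * t ^ 3 / 2 - i * p ∈ K :=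
  sub_mem (div_mem (mul_mem (sub_mem hi (one_mem _)) (pow_mem ht 3)) (ofNat_mem _ _))
    (mul_mem hi hp)

theorem radicand_mem (hi : i ∈ K) (ht : t ∈ K) (hp : p ∈ K) :
    2 * p - 2 * t + 2 * t * p - t ^ 2 + i * t ^ 2 ∈ K := by
  repeat' first
    | assumption | exact one_mem _ | exact ofNat_mem _ _
    | apply add_mem | apply sub_mem | apply mul_mem | apply pow_mem

end Membership

theorem IsExpressed.sub_notMem {y i t p : Ω} (h : IsExpressed y i t p) :
    y - ((i - 1) * t ^ 3 / 2 - i * p) ∉ fourField i t p := by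
  have : CharZero Ω := algebraRat.charZero Ω
  exact fun hW => h.toIsTower.w_notMem h.isLastGen
    (mul_mem (topFactorInv_mem i_mem_fourField t_mem_fourField p_mem_fourField) hW)

/-- Any two towers generate the same field. -/
theorem IsTower.mem_of_isTower {i t p i' t' p' : Ω} (hT : IsTower i t p)
    (hT' : IsTower i' t' p') :
    i' ∈ cyclotomicField i t ⊔ ℚ⟮t⟯ ∧ t' ∈ cyclotomicField i t ⊔ ℚ⟮t⟯ ∧
      ∃ ν ∈ cyclotomicField i t ⊔ ℚ⟮t⟯, p' = ν * p := by
  have : CharZero Ω := algebraRat.charZero Ω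
  obtain ⟨hi, ht, hp⟩ := hT
  obtain ⟨hi', ht', hp'⟩ := hT'
  have hiN : i ∈ cyclotomicField i t ⊔ ℚ⟮t⟯ :=
    (le_sup_left : cyclotomicField i t ≤ cyclotomicField i t ⊔ ℚ⟮t⟯) i_mem_cyclotomicField
  have htN : t ∈ cyclotomicField i t ⊔ ℚ⟮t⟯ := mem_sup_adjoin_self _ _
  have ht2 : t' ^ 2 = t ^ 2 ∨ t' ^ 2 = -t ^ 2 :=
    sq_eq_sq_iff_eq_or_eq_neg.mp (by rw [← pow_mul, ← pow_mul, ht, ht'])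
  refine ⟨?_, ?_, ?_⟩
  · rcases sq_eq_sq_iff_eq_or_eq_neg.mp (hi'.trans hi.symm) with rfl | rfl
    exacts [hiN, neg_mem hiN]
  · rcases ht2 with h | h
    · rcases sq_eq_sq_iff_eq_or_eq_neg.mp h with rfl | rfl
      exacts [htN, neg_mem htN]
    · have : t' ^ 2 = (i * t) ^ 2 := by rw [h, mul_pow, hi]; ring
      rcases sq_eq_sq_iff_eq_or_eq_neg.mp this with rfl | rfl
      exacts [mul_mem hiN htN, neg_mem (mul_mem hiN htN)]
  · have key : ∀ ν ∈ cyclotomicField i t ⊔ ℚ⟮t⟯, p' ^ 2 = (ν * p) ^ 2 →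
        ∃ ν ∈ cyclotomicField i t ⊔ ℚ⟮t⟯, p' = ν * p := by
      intro ν hν h
      rcases sq_eq_sq_iff_eq_or_eq_neg.mp h with h | h
      exacts [⟨ν, hν, h⟩, ⟨-ν, neg_mem hν, by rw [h]; ring⟩]
    rcases ht2 with h | h
    · exact key 1 (one_mem _) (by rw [hp', h, one_mul, hp])
    -- `(√2 - 1)(√2 + 1) = 1` gives `√(1 - √2) = ±i(√2 - 1)√(1 + √2)`.
    · refine key (i * (t ^ 2 - 1)) (mul_mem hiN (sub_mem (pow_mem htN 2) (one_mem _))) ?_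
      grind

/-- The tower is determined by `i`, `(i - 1) t³ / 2` and `ip`. -/
theorem IsTower.eq_of_eq {i t p i' t' p' : Ω} (hT : IsTower i t p) (hT' : IsTower i' t' p')
    (hη : (i' - 1) * t' ^ 3 = (i - 1) * t ^ 3) (hg : i' * p' = i * p) :
    i = i' ∧ t = t' ∧ p = p' := by
  have : CharZero Ω := algebraRat.charZero Ω
  obtain ⟨hi, ht, hp⟩ := hT
  obtain ⟨hi', ht', hp'⟩ := hT'
  have hi0 : i ≠ 0 := by rintro rfl; norm_num at hi
  have ht0 : t ≠ 0 := by rintro rfl; norm_num at ht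
  -- Squaring `ip` gives `-(1 + t²)`, which fixes `t²`. Squaring `(i - 1)t³` gives `-2it⁶`, which
  -- then fixes `i`.
  have hss : t' ^ 2 = t ^ 2 := by
    linear_combination p' ^ 2 * hi' - p ^ 2 * hi - (i' * p' + i * p) * hg - hp' + hp
  have hii : i = i' := by
    have h6 : t' ^ 6 = t ^ 6 := by
      linear_combination (t' ^ 4 + t' ^ 2 * t ^ 2 + t ^ 4) * hss
    have : 2 * (i - i') * t ^ 6 = 0 := by
      linear_combination ((i' - 1) * t' ^ 3 + (i - 1) * t ^ 3) * hη - t' ^ 6 * hi' + t ^ 6 * hi +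
        2 * i' * h6
    have := (mul_eq_zero.mp this).resolve_right (pow_ne_zero _ ht0)
    exact sub_eq_zero.mp ((mul_eq_zero.mp this).resolve_left two_ne_zero)
  subst hii
  refine ⟨rfl, ?_, (mul_left_cancel₀ hi0 hg).symm⟩
  have hi1 : i - 1 ≠ 0 := by
    intro h
    have : (2 : Ω) = 0 := by linear_combination hi - (i + 1) * h
    exact two_ne_zero this
  have h3 : (i - 1) * t ^ 2 * t = (i - 1) * t ^ 2 * t' := by
    linear_combination (i - 1) * t' * hss - hη
  exact mul_left_cancel₀ (mul_ne_zero hi1 (pow_ne_zero _ ht0)) h3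

/-- The tower through which a root of `f8` is expressed is unique. -/
theorem IsExpressed.unique {y i t p i' t' p' : Ω} (h : IsExpressed y i t p)
    (h' : IsExpressed y i' t' p') : i = i' ∧ t = t' ∧ p = p' := by
  have : CharZero Ω := algebraRat.charZero Ω
  have hW := h.sub_notMem
  obtain ⟨hT, hE⟩ := h
  obtain ⟨hT', hE'⟩ := h'
  obtain ⟨hi'N, ht'N, ν, hνN, hν⟩ := hT.mem_of_isTower hT'
  have hiN : i ∈ cyclotomicField i t ⊔ ℚ⟮t⟯ :=
    (le_sup_left : cyclotomicField i t ≤ cyclotomicField i t ⊔ ℚ⟮t⟯) i_mem_cyclotomicField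
  have htN : t ∈ cyclotomicField i t ⊔ ℚ⟮t⟯ := mem_sup_adjoin_self _ _
  have hNM : cyclotomicField i t ⊔ ℚ⟮t⟯ ≤ fourField i t p := by
    refine sup_le ((le_sup_left : _ ≤ octicField i t p).trans le_sup_left) ?_
    rw [adjoin_simple_le_iff]
    exact t_mem_fourField
  have hp'M : p' ∈ fourField i t p := hν ▸ mul_mem (hNM hνN) p_mem_fourField
  have hmem : ∀ {i' t' : Ω}, i' ∈ cyclotomicField i t ⊔ ℚ⟮t⟯ → t' ∈ cyclotomicField i t ⊔ ℚ⟮t⟯ →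
      (i' - 1) * t' ^ 3 / 2 ∈ cyclotomicField i t ⊔ ℚ⟮t⟯ := fun hi ht =>
    div_mem (mul_mem (sub_mem hi (one_mem _)) (pow_mem ht 3)) (ofNat_mem _ _)
  obtain ⟨δ, hδ⟩ : ∃ δ, δ =
    (i - 1) * t ^ 3 / 2 - i * p - ((i' - 1) * t' ^ 3 / 2 - i' * p') := ⟨_, rfl⟩
  have hδM : δ ∈ fourField i t p := hδ ▸ sub_mem
    (shift_mem i_mem_fourField t_mem_fourField p_mem_fourField)
    (shift_mem (hNM hi'N) (hNM ht'N) hp'M)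
  -- With `W` and `W + δ` the two last square roots, `2δW` is the difference of the radicands minus
  -- `δ²`, all in `ℚ(i, t, p)`. Thus `δ ≠ 0` would put `W` in that field.
  have hδ0 : δ = 0 := by
    by_contra hδ0
    apply hW
    have hW2 : y - ((i - 1) * t ^ 3 / 2 - i * p) =
        ((2 * p' - 2 * t' + 2 * t' * p' - t' ^ 2 + i' * t' ^ 2) -
        (2 * p - 2 * t + 2 * t * p - t ^ 2 + i * t ^ 2) - δ ^ 2) / (2 * δ) := by
      rw [eq_div_iff (mul_ne_zero two_ne_zero hδ0), ← hE, ← hE', hδ]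
      ring
    rw [hW2]
    exact div_mem (sub_mem (sub_mem (radicand_mem (hNM hi'N) (hNM ht'N) hp'M)
      (radicand_mem i_mem_fourField t_mem_fourField p_mem_fourField)) (pow_mem hδM 2))
      (mul_mem (ofNat_mem _ _) hδM)
  obtain ⟨h1, h2⟩ := eq_zero_of_add_mul_eq_zero hT.p_notMem_sup
    (x := (i - 1) * t ^ 3 / 2 - (i' - 1) * t' ^ 3 / 2) (y := i' * ν - i)
    (sub_mem (hmem hiN htN) (hmem hi'N ht'N))
    (sub_mem (mul_mem hi'N hνN) hiN) (by rw [← hδ0, hδ, hν]; ring)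
  exact hT.eq_of_eq hT' (by linear_combination -2 * h1)
    (by rw [hν]; linear_combination p * h2)

theorem mem_of_add_mul_eq_zero {K : IntermediateField ℚ Ω} {a b e : Ω} (h : a + e * b = 0)
    (ha : a ∈ K) (hb : b ∈ K) (hb0 : b ≠ 0) : e ∈ K := by
  rw [show e = -a / b by rw [eq_div_iff hb0]; linear_combination h]
  exact div_mem (neg_mem ha) hb

theorem IsExpressed.adjoin_eq {β i t p : Ω} (h : IsExpressed (2 * β + 1) i t p)
    (hi : i ∈ ℚ⟮β⟯) (ht : t ∈ ℚ⟮β⟯) (hp : p ∈ ℚ⟮β⟯) :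
    ℚ⟮β⟯ = eightField i t p
      (topFactorInv i t p * (2 * β + 1 - ((i - 1) * t ^ 3 / 2 - i * p))) := by
  have : CharZero Ω := algebraRat.charZero Ω
  have hβ : β ∈ ℚ⟮β⟯ := mem_adjoin_simple_self ℚ β
  apply le_antisymm
  · rw [adjoin_simple_le_iff]
    obtain ⟨w, hw⟩ : ∃ w, w =
      topFactorInv i t p * (2 * β + 1 - ((i - 1) * t ^ 3 / 2 - i * p)) := ⟨_, rfl⟩
    rw [← hw]
    have hle : fourField i t p ≤ eightField i t p w := le_sup_left
    have hβeq : β = (topFactor i t p * w + ((i - 1) * t ^ 3 / 2 - i * p) - 1) / 2 := by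
      rw [hw, ← mul_assoc, h.toIsTower.topFactor_mul]
      ring
    rw [hβeq]
    exact div_mem (sub_mem (add_mem (mul_mem
      (hle (topFactor_mem i_mem_fourField t_mem_fourField p_mem_fourField))
      (mem_sup_adjoin_self _ _))
      (hle (shift_mem i_mem_fourField t_mem_fourField p_mem_fourField))) (one_mem _))
      (ofNat_mem _ _)
  · refine sup_le (sup_le (sup_le (sup_le (sup_le bot_le ?_) ?_) ?_) ?_) ?_ <;>
      rw [adjoin_simple_le_iff]
    · exact hi
    · exact pow_mem ht 2
    · exact hp
    · exact ht
    · exact mul_mem (topFactorInv_mem hi ht hp) (sub_mem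
        (add_mem (mul_mem (ofNat_mem _ _) hβ) (one_mem _)) (shift_mem hi ht hp))

/-- Every root of `f8` generates the field `ℚ(i, t, p, w)` of a suitable tower. -/
theorem exists_adjoin_eq_eightField [IsAlgClosed Ω] {β : Ω} (hβ : aeval β f8 = 0) :
    ∃ i t p w : Ω, IsTower i t p ∧ IsLastGen t p w ∧ ℚ⟮β⟯ = eightField i t p w := by
  have : CharZero Ω := algebraRat.charZero Ω
  have hyK : 2 * β + 1 ∈ ℚ⟮β⟯ :=
    add_mem (mul_mem (ofNat_mem _ _) (mem_adjoin_simple_self ℚ β)) (one_mem _)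
  obtain ⟨i, hi, h₁⟩ : ∃ i : Ω, i ^ 2 = -1 ∧ partRe (2 * β + 1) + i * partIm (2 * β + 1) = 0 :=
    exists_sq_eq_add_mul_eq_zero (by
      rw [neg_one_mul, sub_neg_eq_add, partRe_sq_add_partIm_sq, hβ, mul_zero])
  obtain ⟨κ, hκ, h₂⟩ := exists_kappa hi h₁
  obtain ⟨η, hη, h₃⟩ := exists_eta hi hκ h₂
  obtain ⟨g, hg, h₄⟩ := exists_gamma hi hκ hη h₃
  have hE := IsExpressed.of_partX hi hκ hη hg h₄
  have hi0 : i ≠ 0 := by rintro rfl; norm_num at hi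
  have hκ0 : κ ≠ 0 := by rintro rfl; norm_num at hκ
  have ht0 : (1 - i) * κ * η / 2 ≠ 0 := by
    intro h
    have := hE.ht
    rw [h] at this
    norm_num at this
  have hp0 : -i * g ≠ 0 := by
    intro h
    have h1 := hE.hp
    have h2 := hE.sq_sq
    rw [h] at h1
    have : (1 : Ω) = 0 := by linear_combination -h2 - (((1 - i) * κ * η / 2) ^ 2 - 1) * h1
    exact one_ne_zero this
  -- The relation solves for `i` unless its coefficient `partIm` vanishes. In that case `-i`
  -- satisfies the relation too and leads to a second tower for the same `y`, against uniqueness.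
  -- The same argument serves for `κ`, `η` and `g` below, where a sign change alters `t` or `p`.
  have hiK : i ∈ ℚ⟮β⟯ := by
    refine mem_of_add_mul_eq_zero h₁ (partRe_mem hyK) (partIm_mem hyK) fun h0 => ?_
    rw [h0, mul_zero, add_zero] at h₁
    have hi' : (-i) ^ 2 = -1 := by rw [neg_sq, hi]
    obtain ⟨κ', hκ', h₂'⟩ := exists_kappa hi' (show _ + _ * partIm (2 * β + 1) = 0 by
      rw [h0, h₁, mul_zero, add_zero])
    obtain ⟨η', hη', h₃'⟩ := exists_eta hi' hκ' h₂'
    obtain ⟨g', hg', h₄'⟩ := exists_gamma hi' hκ' hη' h₃'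
    exact hi0 (self_eq_neg.mp (hE.unique (IsExpressed.of_partX hi' hκ' hη' hg' h₄')).1)
  have hκK : κ ∈ ℚ⟮β⟯ := by
    refine mem_of_add_mul_eq_zero h₂ (add_mem (partA_mem hyK) (mul_mem (partB_mem hyK) hiK))
      (add_mem (partC_mem hyK) (mul_mem (partD_mem hyK) hiK)) fun h0 => ?_
    rw [h0, mul_zero, add_zero] at h₂
    have hκ' : (-κ) ^ 2 = -2 := by rw [neg_sq, hκ]
    obtain ⟨η', hη', h₃'⟩ := exists_eta (y := 2 * β + 1) hi hκ' (by
      rw [h0, h₂, mul_zero, add_zero])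
    obtain ⟨g', hg', h₄'⟩ := exists_gamma hi hκ' hη' h₃'
    have hu := (hE.unique (IsExpressed.of_partX hi hκ' hη' hg' h₄')).2.1
    have : ((1 - i) * κ / 2) * η = ((1 - i) * κ / 2) * (-η') := by linear_combination hu
    have := mul_left_cancel₀ (fun h => ht0 (by linear_combination η * h)) this
    exact hκ0 (self_eq_neg.mp (by rw [← hη', ← hη, this]; ring))
  have hηK : η ∈ ℚ⟮β⟯ := by
    refine mem_of_add_mul_eq_zero h₃ (partU_mem hyK hiK hκK) (partV_mem hyK hiK hκK) fun h0 => ?_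
    rw [h0, mul_zero, add_zero] at h₃
    have hη' : (-η) ^ 2 = κ := by rw [neg_sq, hη]
    obtain ⟨g', hg', h₄'⟩ := exists_gamma (y := 2 * β + 1) hi hκ hη' (by
      rw [h0, h₃, mul_zero, add_zero])
    have hu := (hE.unique (IsExpressed.of_partX hi hκ hη' hg' h₄')).2.1
    exact ht0 (self_eq_neg.mp (hu.trans (by ring)))
  have hgK : g ∈ ℚ⟮β⟯ := by
    refine mem_of_add_mul_eq_zero h₄ (partX_mem hyK hiK hκK hηK) (partY_mem hyK hiK hκK hηK)
      fun h0 => ?_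
    rw [h0, mul_zero, add_zero] at h₄
    have hg' : (-g) ^ 2 = -1 - i * κ := by rw [neg_sq, hg]
    have hu := (hE.unique (IsExpressed.of_partX hi hκ hη hg' (by
      rw [h0, h₄, mul_zero, add_zero]))).2.2
    exact hp0 (self_eq_neg.mp (hu.trans (by ring)))
  exact ⟨i, _, _, _, hE.toIsTower, hE.isLastGen, hE.adjoin_eq hiK
    (div_mem (mul_mem (mul_mem (sub_mem (one_mem _) hiK) hκK) hηK) (ofNat_mem _ _))
    (mul_mem (neg_mem hiK) hgK)⟩

end CurveE

/-! ### The division fields -/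

namespace CurveE

theorem exists_isTower {Ω : Type*} [Field Ω] [IsAlgClosed Ω] :
    ∃ i t p w : Ω, IsTower i t p ∧ IsLastGen t p w := by
  obtain ⟨i, hi⟩ := IsAlgClosed.exists_pow_nat_eq (-1 : Ω) two_pos
  obtain ⟨t, ht⟩ := IsAlgClosed.exists_pow_nat_eq (2 : Ω) four_pos
  obtain ⟨p, hp⟩ := IsAlgClosed.exists_pow_nat_eq (1 + t ^ 2) two_pos
  obtain ⟨w, hw⟩ := IsAlgClosed.exists_pow_nat_eq
    (4 * p - 2 * t ^ 2 - 2 * t ^ 3 * (1 - p)) two_pos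
  exact ⟨i, t, p, w, ⟨hi, ht, hp⟩, hw⟩

/-! ### Roots of `f4`, and the division fields as composita -/

variable {Ω : Type*} [Field Ω] [Algebra ℚ Ω]

/-- Every root of `f4` generates the field `ℚ(i, √2, p)` of a tower with prescribed `t`. -/
theorem exists_adjoin_eq_octicField {α t : Ω} (hα : aeval α f4 = 0) (ht : t ^ 4 = 2) :
    ∃ i p : Ω, IsTower i t p ∧ ℚ⟮α⟯ = octicField i t p := by
  have : CharZero Ω := algebraRat.charZero Ω
  have hα8 : α ^ 8 + 6 * α ^ 4 + 1 = 0 := by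
    simpa only [f4, map_add, map_mul, map_pow, aeval_X, map_ofNat, map_one] using hα
  have hα0 : α ≠ 0 := by rintro rfl; norm_num at hα8
  have ht0 : t ≠ 0 := by rintro rfl; norm_num at ht
  have hαK : α ∈ ℚ⟮α⟯ := mem_adjoin_simple_self ℚ α
  -- Dividing `f4(α) = 0` by `α⁴` gives `α⁴ + α⁻⁴ = -6`, so half the sum and half the difference of
  -- `α²` and `α⁻²` have squares `-1` and `-2`.
  obtain ⟨i, hidef⟩ : ∃ i, i = (α ^ 4 + 1) / (2 * α ^ 2) := ⟨_, rfl⟩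
  obtain ⟨θ, hθdef⟩ : ∃ θ, θ = (α ^ 4 - 1) / (2 * α ^ 2) := ⟨_, rfl⟩
  have hiK : i ∈ ℚ⟮α⟯ := hidef ▸ div_mem (add_mem (pow_mem hαK 4) (one_mem _))
    (mul_mem (ofNat_mem _ _) (pow_mem hαK 2))
  have hθK : θ ∈ ℚ⟮α⟯ := hθdef ▸ div_mem (sub_mem (pow_mem hαK 4) (one_mem _))
    (mul_mem (ofNat_mem _ _) (pow_mem hαK 2))
  have hi : i ^ 2 = -1 := by
    rw [hidef, div_pow, div_eq_iff (by simp [hα0])]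
    linear_combination hα8
  have hθ : θ ^ 2 = -2 := by
    rw [hθdef, div_pow, div_eq_iff (by simp [hα0])]
    linear_combination hα8
  have hα2 : α ^ 2 = i + θ := by
    rw [hidef, hθdef]
    field_simp
    ring
  have hi0 : i ≠ 0 := by rintro rfl; norm_num at hi
  have hi1 : 1 + i ≠ 0 := by
    intro h
    have : (2 : Ω) = 0 := by linear_combination hi + (1 - i) * h
    exact two_ne_zero this
  have hs : t ^ 2 = i * θ ∨ t ^ 2 = -(i * θ) :=
    sq_eq_sq_iff_eq_or_eq_neg.mp (by rw [← pow_mul, ht, mul_pow, hi, hθ]; norm_num)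
  have hsK : t ^ 2 ∈ ℚ⟮α⟯ := by
    rcases hs with h | h <;> rw [h]
    exacts [mul_mem hiK hθK, neg_mem (mul_mem hiK hθK)]
  have h1iK : 1 + i ∈ ℚ⟮α⟯ := add_mem (one_mem _) hiK
  have h1i {p : Ω} : 1 + i ∈ octicField i t p := add_mem (one_mem _)
    ((le_sup_left : cyclotomicField i t ≤ octicField i t p) i_mem_cyclotomicField)
  have hiO {p : Ω} : i ∈ octicField i t p :=
    (le_sup_left : cyclotomicField i t ≤ octicField i t p) i_mem_cyclotomicField
  have hle : ∀ {p : Ω}, p ∈ ℚ⟮α⟯ → octicField i t p ≤ ℚ⟮α⟯ := by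
    intro p hp
    refine sup_le (sup_le (sup_le bot_le ?_) ?_) ?_ <;> rw [adjoin_simple_le_iff]
    exacts [hiK, hsK, hp]
  -- According to the sign, `α²` is `i(1 - t²)` or `i(1 + t²)`. Since `(1 + i)/t²` is a square root
  -- of `i` and `(1 - t²)(1 + t²) = -1`, a square root of `1 + t²` is obtained from `α⁻¹` or from
  -- `α`.
  rcases hs with h | h
  · refine ⟨i, i * (1 + i) / (α * t ^ 2), ⟨hi, ht, ?_⟩, le_antisymm ?_ (hle ?_)⟩
    · rw [div_pow, mul_pow α, hα2, div_eq_iff (by simp [← hα2, hα0, ht0])]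
      grind
    · rw [adjoin_simple_le_iff]
      obtain ⟨p, hp⟩ : ∃ p, p = i * (1 + i) / (α * t ^ 2) := ⟨_, rfl⟩
      rw [← hp, show α = i * (1 + i) / (p * t ^ 2) by rw [hp]; field_simp]
      exact div_mem (mul_mem hiO h1i) (mul_mem p_mem_octicField sq_mem_octicField)
    · exact div_mem (mul_mem hiK h1iK) (mul_mem hαK hsK)
  · refine ⟨i, α * t ^ 2 / (1 + i), ⟨hi, ht, ?_⟩, le_antisymm ?_ (hle ?_)⟩
    · rw [div_pow, mul_pow α, hα2, div_eq_iff (pow_ne_zero _ hi1)]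
      grind
    · rw [adjoin_simple_le_iff]
      obtain ⟨p, hp⟩ : ∃ p, p = α * t ^ 2 / (1 + i) := ⟨_, rfl⟩
      rw [← hp, show α = p * (1 + i) / t ^ 2 by rw [hp]; field_simp]
      exact div_mem (mul_mem p_mem_octicField h1i) sq_mem_octicField
    · exact div_mem (mul_mem hαK hsK) h1iK

theorem adjoin_pair_eq_sup (a b : Ω) : adjoin ℚ {a, b} = ℚ⟮a⟯ ⊔ ℚ⟮b⟯ := by
  rw [Set.insert_eq, adjoin_union]

theorem finrank_adjoin_sqrt_two {s : Ω} (hs : s ^ 2 = 2) : Module.finrank ℚ ℚ⟮s⟯ = 2 := by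
  have h := finrank_sup_adjoin (F := ⊥) (hs ▸ ofNat_mem _ _)
    (fun h => not_isSquareIn_bot_two (Ω := Ω) ⟨s, h, hs⟩)
  rwa [bot_sup_eq, IntermediateField.finrank_bot] at h

variable [DecidableEq Ω]

theorem divisionField_four_eq {d : ℤ} (hd : d ≠ 0) {r i t p : Ω} (hr : r ^ 2 = d)
    (hT : IsTower i t p) : divisionField (curveE d) Ω 4 = octicField i t p ⊔ ℚ⟮r * t⟯ := by
  have hle : octicField i t p ≤ octicField i t p ⊔ ℚ⟮r * t⟯ := le_sup_left
  apply le_antisymm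
  · exact divisionField_four_le hd hr hT
      (hle ((le_sup_left : cyclotomicField i t ≤ octicField i t p) i_mem_cyclotomicField))
      (hle sq_mem_octicField) (hle p_mem_octicField) (mem_sup_adjoin_self _ _)
  · obtain ⟨hi, hs, hp, hrt⟩ := mem_divisionField_four hd hr hT
    refine sup_le (sup_le (sup_le (sup_le bot_le ?_) ?_) ?_) ?_ <;> rw [adjoin_simple_le_iff]
    exacts [hi, hs, hp, hrt]

theorem divisionField_eight_eq {d : ℤ} (hd : d ≠ 0) {r i t p w : Ω} (hr : r ^ 2 = d)
    (hT : IsTower i t p) (hw : IsLastGen t p w) :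
    divisionField (curveE d) Ω 8 = eightField i t p w ⊔ ℚ⟮r⟯ := by
  have hle' : eightField i t p w ≤ eightField i t p w ⊔ ℚ⟮r⟯ := le_sup_left
  have hle : fourField i t p ≤ eightField i t p w ⊔ ℚ⟮r⟯ := le_sup_left.trans hle'
  apply le_antisymm
  · exact divisionField_eight_le hd hr hT hw (hle i_mem_fourField) (hle t_mem_fourField)
      (hle p_mem_fourField) (hle' (mem_sup_adjoin_self _ _)) (mem_sup_adjoin_self _ _)
  · obtain ⟨hiD, htD, hpD, hwD, hrD⟩ := mem_divisionField_eight hd hr hT hw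
    refine sup_le (sup_le (sup_le (sup_le (sup_le (sup_le bot_le ?_) ?_) ?_) ?_) ?_) ?_ <;>
      rw [adjoin_simple_le_iff]
    exacts [hiD, pow_mem htD 2, hpD, htD, hwD, hrD]

end CurveE

open CurveE

theorem mainTheorem7 {Ω : Type*} [Field Ω] [Algebra ℚ Ω] [IsAlgClosed Ω] [DecidableEq Ω]
    (d : ℤ) (hd : Squarefree d) :
    (∀ s : Ω, s ^ 2 = 2 →
      divisionField (curveE d) Ω 2 = IntermediateField.adjoin ℚ {s}) ∧
    (∀ α r t : Ω, aeval α f4 = 0 → r ^ 2 = (d : Ω) → t ^ 4 = 2 →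
      divisionField (curveE d) Ω 4 = IntermediateField.adjoin ℚ {α, r * t}) ∧
    (∀ β r : Ω, aeval β f8 = 0 → r ^ 2 = (d : Ω) →
      divisionField (curveE d) Ω 8 = IntermediateField.adjoin ℚ {β, r}) ∧
    Module.finrank ℚ (divisionField (curveE d) Ω 2) = 2 ∧
    Module.finrank ℚ (divisionField (curveE d) Ω 4) = 16 ∧
    (Module.finrank ℚ (divisionField (curveE d) Ω 8) = 32 ↔
      d = 1 ∨ d = -1 ∨ d = 2 ∨ d = -2) ∧
    (¬ (d = 1 ∨ d = -1 ∨ d = 2 ∨ d = -2) →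
      Module.finrank ℚ (divisionField (curveE d) Ω 8) = 64) := by
  have hd0 : d ≠ 0 := hd.ne_zero
  obtain ⟨i, t, p, w, hT, hw⟩ := exists_isTower (Ω := Ω)
  obtain ⟨r, hr⟩ := IsAlgClosed.exists_pow_nat_eq (d : Ω) two_pos
  have hmem := hT.mem_eightField_iff hw hd hr
  have h32 : r ∈ eightField i t p w → Module.finrank ℚ (divisionField (curveE d) Ω 8) = 32 := by
    intro h
    rw [divisionField_eight_eq hd0 hr hT hw, sup_eq_left.mpr (adjoin_simple_le_iff.mpr h),
      hT.finrank_eightField hw]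
  have h64 : r ∉ eightField i t p w → Module.finrank ℚ (divisionField (curveE d) Ω 8) = 64 := by
    intro h
    rw [divisionField_eight_eq hd0 hr hT hw, finrank_sup_adjoin (hr ▸ intCast_mem _ _) h,
      hT.finrank_eightField hw]
  refine ⟨fun s hs => divisionField_two_eq hd0 hs, ?_, ?_, ?_, ?_, ?_, ?_⟩
  · intro α r t hα hr ht
    obtain ⟨i, p, hT, hα⟩ := exists_adjoin_eq_octicField hα ht
    rw [divisionField_four_eq hd0 hr hT, adjoin_pair_eq_sup, hα]
  · intro β r hβ hr
    obtain ⟨i, t, p, w, hT, hw, hβ⟩ := exists_adjoin_eq_eightField hβ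
    rw [divisionField_eight_eq hd0 hr hT hw, adjoin_pair_eq_sup, hβ]
  · rw [divisionField_two_eq hd0 hT.sq_sq, finrank_adjoin_sqrt_two hT.sq_sq]
  · rw [divisionField_four_eq hd0 hr hT, hT.finrank_octicField_sup hd0 hr]
  · refine ⟨fun h => ?_, fun h => h32 (hmem.mpr h)⟩
    by_contra hne
    have := h64 (mt hmem.mp hne)
    omega
  · exact fun h => h64 (mt hmem.mp h)
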